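/- **Conventions.** For $B\subset\mathbb R^L$ put $\mathrm{Dom}(B)=\{s\in\mathbb R^L: \exists s'\in B,\ s\le s'\}$ (componentwise order) and $\mathrm{Par}(B)=\partial\,\mathrm{Dom}(B)$; $\mathrm{dist}(a,B)=\inf_{b\in B}\|a-b\|_\infty$. Maxima and minima of distances are read as suprema and infima in $[0,\infty]$. **Setting.** Let $\mathcal X,\Omega$ be compact convex subsets of Euclidean spaces and, for $m\in[M]$, let $k^{(m)}$ be a measurable positive-definite kernel on $\mathcal X\times\Omega$ with $k^{(m)}(z,z)\le 1$, and let $f^{(m)}$ be in the RKHS of $k^{(m)}$ with norm at most $B_m$. At each step $t\ge0$ a point $(x_{t+1},w_{t+1})\in\mathcal X\times\Omega$ is chosen using only the past (the first $t$ observations and possibly auxiliary randomness), and $y^{(m)}_{t+1}=f^{(m)}(x_{t+1},w_{t+1})+\eta^{(m)}_{t+1}$ is observed for all $m$. Let $\delta\in(0,1)$ and $\epsilon>0$. Two models are considered. *(A) Gaussian noise, simulator setting.* $\eta^{(m)}_{t+1}\sim N(0,\varsigma_m^2)$, $\varsigma_m>0$, is independent of the past and of the query point. $\mu^{(m)}_t,\sigma^{(m)}_t$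 are the posterior mean and standard deviation, after $t$ observations, of a Gaussian process with prior $\mathcal{GP}(0,k^{(m)})$ and noise variance $\varsigma_m^2$; $\kappa^{(m)}_t=\frac12\sup\log\det(I_t+\varsigma_m^{-2}K)$, the supremum being over the Gram matrices $K$ of $k^{(m)}$ at $t$ points of $\mathcal X\times\Omega$; and $\beta^{1/2}_{m,t}=B_m+\sqrt{2(\kappa^{(m)}_t+\log(M/\delta))}$. For each $m$ there is one risk measure $\rho^{(m)}$, that is, a real functional on a class of admissible functions on $\Omega$, and $F^{(m)}(x)=\rho^{(m)}(f^{(m)}(x,\cdot))$. Put $\Omega_x=\Omega$ for all $x$. *(B) Heteroscedastic sub-Gaussian noise, environment depending on $x$, simulator or uncontrollable setting.* Given the past and the query point $z$, $\eta^{(m)}_{t+1}$ is centred and $\tau_{z,m}$-sub-Gaussian, where $\tau$ is measurable and $\tau_{z,m}\in[\underline\tau,\bar\tau]$ with $\underline\tau>0$. Each $\Omega_x\subset\Omega$ is compact and convex. $w_{t+1}\in\Omega_{x_{t+1}}$ is chosen by the user (simulator setting), or is drawn, given the past and $x_{t+1}$, from a distribution $P_w(x_{t+1})$ concentrated on $\Omega_{x_{t+1}}$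 (uncontrollable setting). For given $\lambda_m>0$, $\mu^{(m)}_t,\sigma^{(m)}_t$ are the posterior mean and standard deviation for the prior $\mathcal{GP}(0,\lambda_m^{-1}k^{(m)})$ and noise variances $\tau^2_{z_j,m}$, $z_j=(x_j,w_j)$. For a fixed integer $r\ge0$, $$\beta^{1/2}_{m,t+1}=B_m\sqrt{\lambda_m}+\sqrt{2\log\frac{\det(\lambda_m\Sigma+K)^{1/2}}{M^{-1}\delta\det(\lambda_m\Sigma)^{1/2}}},$$ where $K$ is the Gram matrix of $k^{(m)}$ at the first $t+r$ query points $z_j$ and $\Sigma=\mathrm{diag}(\tau^2_{z_j,m})$. For each $m$ there are risk measures $\rho^{(m,l)}_x$, $l\in[L_m]$ (functionals as in (A), possibly depending on $x$), and $F^{(m,l)}(x)=\rho^{(m,l)}_x(f^{(m)}(x,\cdot))$. In both models $f^{(m)}(x,\cdot)$ is admissible for the risk measures applied to it, $F$ is the vector of all the functions $F^{(j)}$ ($j=m$ in (A), $j=(m,l)$ in (B); write $\rho^{(j)}_x=\rho^{(m)}$ in (A)), $Z^*=\mathrm{Par}(F(\mathcal X))$, and $G^{(j)}_t(x)$ is the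 set of admissible functions $g$ on $\Omega$ with $|g(w)-\mu^{(m)}_t(x,w)|\le\beta^{1/2}_{m,t+1}\sigma^{(m)}_t(x,w)$ for all $w\in\Omega$. **Algorithm and errors.** For each $t\ge0$ let real numbers $\mathrm{lcb}^{(j)}_t(x),\mathrm{ucb}^{(j)}_t(x)$ ($x\in\mathcal X$), with vectors $\mathbf{LCB}_t(x),\mathbf{UCB}_t(x)$, and a set $\hat\Pi_t\subset\mathcal X$ be given (possibly depending on the data and on auxiliary randomness), where the elements of $\hat\Pi_t$ are mutually non-dominated in the sense that $\mathbf{LCB}_t(\hat\Pi_t)\subset\mathrm{Par}(\mathbf{LCB}_t(\hat\Pi_t))$. Put $$a^{(\mathcal X)}_t(x)=\mathrm{dist}\big(\mathbf{UCB}_t(x),\mathrm{Dom}(\mathbf{LCB}_t(\hat\Pi_t))\big),\qquad a^{(\Omega)}_t(w)=\sum_{m}2\beta^{1/2}_{m,t+1}\sigma^{(m)}_t(x_{t+1},w).$$ Let $\epsilon_{\rm lcb},\epsilon_{\rm ucb},\epsilon_{\rm PF},\epsilon_{\mathcal X},\epsilon_\Omega\ge0$, and suppose that almost surely, for all $t\ge0$,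 all $j$, all $x\in\mathcal X$ and all $g\in G^{(j)}_t(x)$, $$\mathrm{lcb}^{(j)}_t(x)-\epsilon_{\rm lcb}\le\rho^{(j)}_x(g)\le\mathrm{ucb}^{(j)}_t(x)+\epsilon_{\rm ucb},$$ $$\max_{y\in\mathrm{Par}(\mathbf{LCB}_t(\hat\Pi_t))}\mathrm{dist}\big(y,\mathrm{Par}(\mathbf{LCB}_t(\mathcal X))\big)\le\epsilon_{\rm PF},\qquad \max_{x\in\mathcal X}a^{(\mathcal X)}_t(x)-a^{(\mathcal X)}_t(x_{t+1})\le\epsilon_{\mathcal X},$$ and, in the simulator setting only, $\max_{w\in\Omega_{x_{t+1}}}a^{(\Omega)}_t(w)-a^{(\Omega)}_t(w_{t+1})\le\epsilon_\Omega$. **Conclusion.** Let $I_t=\max\big\{\max_{y\in Z^*}\mathrm{dist}(y,\mathrm{Par}(F(\hat\Pi_t))),\ \max_{y\in F(\hat\Pi_t)}\mathrm{dist}(y,Z^*)\big\}$ be the inference discrepancy. Then, in each of the models and settings, with probability at least $1-\delta$, $$I_t\le a^{(\mathcal X)}_t(x_{t+1})+\epsilon_{\rm lcb}+\epsilon_{\rm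 ucb}+\epsilon_{\mathcal X}\quad\text{for all }t\ge0,$$ and therefore, with probability at least $1-\delta$, $I_T\le\epsilon+\epsilon_{\rm lcb}+\epsilon_{\rm ucb}+\epsilon_{\mathcal X}$ at every $T$ at which the stopping condition $a^{(\mathcal X)}_T(x_{T+1})\le\epsilon$ is satisfied. -/

import Mathlib

open MeasureTheory ProbabilityTheory
open scoped ENNReal Matrix

namespace ParetoBO

noncomputable section

/-! ### Dominated regions, Pareto fronts, inference discrepancy

Objective vectors are functions `ι → ℝ` on a finite index set; the extended distance of this space
is the sup-distance `d_∞`.  Suprema and infima of distances are taken in `[0, ∞]`. -/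

/-- The region dominated by `B` (larger is better). -/
def Dom {ι : Type*} (B : Set (ι → ℝ)) : Set (ι → ℝ) := {s | ∃ s' ∈ B, s ≤ s'}

/-- The Pareto front of `B`: the boundary of its dominated region. -/
def Par {ι : Type*} (B : Set (ι → ℝ)) : Set (ι → ℝ) := frontier (Dom B)

/-- `sup_{y ∈ A} dist (y, B)`, where `dist (y, B)` is the sup-distance of a point to a set. -/
def maxDist {ι : Type*} [Fintype ι] (A B : Set (ι → ℝ)) : ℝ≥0∞ := ⨆ y ∈ A, Metric.infEDist y B

/-- The inference discrepancy `max {I⁽ⁱ⁾, I⁽ⁱⁱ⁾}` of the set `E` of estimated Pareto solutions for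
the objective map `F`; the target front is `Par (Set.range F)`. -/
def discrepancy {X ι : Type*} [Fintype ι] (F : X → ι → ℝ) (E : Set X) : ℝ≥0∞ :=
  max (maxDist (Par (Set.range F)) (Par (F '' E))) (maxDist (F '' E) (Par (Set.range F)))

/-! ### Gaussian process regression -/

/-- Gram matrix of the points `z`. -/
def gram {Z : Type*} (k : Z → Z → ℝ) {n : ℕ} (z : Fin n → Z) : Matrix (Fin n) (Fin n) ℝ :=
  Matrix.of fun i j => k (z i) (z j)

/-- Posterior mean at `p` for the prior covariance `k`, query points `z`, noise variances `v` and
observations `y`. -/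
def postMean {Z : Type*} (k : Z → Z → ℝ) {n : ℕ} (z : Fin n → Z) (v y : Fin n → ℝ) (p : Z) : ℝ :=
  (fun i => k p (z i)) ⬝ᵥ ((gram k z + Matrix.diagonal v)⁻¹ *ᵥ y)

/-- Posterior standard deviation at `p`. -/
def postSd {Z : Type*} (k : Z → Z → ℝ) {n : ℕ} (z : Fin n → Z) (v : Fin n → ℝ) (p : Z) : ℝ :=
  √(k p p - (fun i => k p (z i)) ⬝ᵥ ((gram k z + Matrix.diagonal v)⁻¹ *ᵥ fun i => k p (z i)))

/-- Maximum information gain of `n` queries for the noise standard deviation `s`. -/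
def infoGain {Z : Type*} (k : Z → Z → ℝ) (s : ℝ) (n : ℕ) : ℝ :=
  2⁻¹ * ⨆ z : Fin n → Z, Real.log ((1 : Matrix (Fin n) (Fin n) ℝ) + (s ^ 2)⁻¹ • gram k z).det

/-- The parameter `β^{1/2}` at index `n` for homoscedastic Gaussian noise; `M` is the number of
black-box functions. -/
def betaGauss {Z : Type*} (k : Z → Z → ℝ) (B s δ : ℝ) (M n : ℕ) : ℝ :=
  B + √(2 * (infoGain k s n + Real.log (M / δ)))

/-- The parameter `β^{1/2}` for heteroscedastic sub-Gaussian noise, formed from the query points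
`z`, the noise variances `v` and the regularisation parameter `lam`. -/
def betaSubG {Z : Type*} (k : Z → Z → ℝ) (B lam δ : ℝ) (M : ℕ) {n : ℕ} (z : Fin n → Z)
    (v : Fin n → ℝ) : ℝ :=
  B * √lam + √(2 * Real.log (√(lam • Matrix.diagonal v + gram k z).det /
    ((M : ℝ)⁻¹ * δ * √(lam • Matrix.diagonal v).det)))

/-! ### Regularity of the black-box functions -/

/-- `f` belongs to the reproducing kernel Hilbert space of the kernel `k` and its norm there is
at most `B`. -/
def InRKHSBall {Z : Type} (k : Z → Z → ℝ) (B : ℝ) (f : Z → ℝ) : Prop :=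
  ∃ (H : Type) (_ : NormedAddCommGroup H) (_ : InnerProductSpace ℝ H) (_ : CompleteSpace H)
    (_ : RKHS ℝ H Z ℝ), (∀ p q, RKHS.kernel H p q 1 = k p q) ∧ ∃ h : H, ⇑h = f ∧ ‖h‖ ≤ B

/-- The regularity assumption: `k` is a (measurable) positive-definite kernel bounded by `1` on the
diagonal and `f` lies in the ball of radius `B` of its RKHS. -/
structure Regular {Z : Type} [MeasurableSpace Z] (k : Z → Z → ℝ) (B : ℝ) (f : Z → ℝ) : Prop where
  measurable : Measurable (Function.uncurry k)
  posDef : (Matrix.of k).PosSemidef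
  diag_le : ∀ p, k p p ≤ 1
  mem : InRKHSBall k B f

/-- A risk measure: a real functional of functions of the environmental variable, defined on the
class `dom` of admissible functions (e.g. all functions, or the integrable ones).  The values of
`val` outside `dom` are never used. -/
structure RiskMeasure (W : Type*) where
  dom : Set (W → ℝ)
  val : (W → ℝ) → ℝ

/-- The admissible functions lying in the band `[μ - b σ, μ + b σ]`. -/
def band {W : Type*} (ρ : RiskMeasure W) (μ σ : W → ℝ) (b : ℝ) : Set (W → ℝ) :=
  {g ∈ ρ.dom | ∀ w, g w ∈ Set.Icc (μ w - b * σ w) (μ w + b * σ w)}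

/-! ### Runs of the optimisation procedure -/

/-- Queries and noise.  Time is shifted by one: `x t`, `w t`, `noise m t` are
`x_{t+1}`, `w_{t+1}` and the noise of the observation of `f^{(m)}` at `(x_{t+1}, w_{t+1})`.
`hist t` is the information available immediately before that observation: it contains the first
`t` observations, the query `(x_{t+1}, w_{t+1})` and any auxiliary randomisation. -/
structure Run (S : Type*) [MeasurableSpace S] (X W : Type*) [MeasurableSpace X]
    [MeasurableSpace W] (M : ℕ) where
  hist : Filtration ℕ (inferInstance : MeasurableSpace S)
  x : ℕ → S → X
  w : ℕ → S → W
  noise : Fin M → ℕ → S → ℝ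
  x_meas : ∀ t, Measurable[hist t] (x t)
  w_meas : ∀ t, Measurable[hist t] (w t)
  noise_meas : ∀ m t, Measurable[hist (t + 1)] (noise m t)

section Run

variable {S X W : Type*} [MeasurableSpace S] [MeasurableSpace X] [MeasurableSpace W] {M : ℕ}

/-- The first `n` query points. -/
def Run.pts (R : Run S X W M) (n : ℕ) (ω : S) : Fin n → X × W := fun i => (R.x i ω, R.w i ω)

/-- The first `n` observations of the function `f = f^{(m)}`. -/
def Run.obs (R : Run S X W M) (f : X × W → ℝ) (m : Fin M) (n : ℕ) (ω : S) : Fin n → ℝ :=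
  fun i => f (R.pts n ω i) + R.noise m i ω

/-- Independent centred Gaussian noise with standard deviations `s m`: each noise variable is
independent of everything that happened before it is realised. -/
def Run.GaussianNoise (R : Run S X W M) (P : Measure S) (s : Fin M → ℝ) : Prop :=
  ∀ m t, P.map (R.noise m t) = gaussianReal 0 (s m ^ 2).toNNReal ∧
    Indep (MeasurableSpace.comap (R.noise m t) inferInstance) (R.hist t) P

/-- Heteroscedastic sub-Gaussian noise: given the past and the query point `z`, the noise in the
observation of `f^{(m)}` is centred and `τ m z`-sub-Gaussian. -/
def Run.SubGaussianNoise (R : Run S X W M) (P : Measure S) (τ : Fin M → X × W → ℝ) : Prop :=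
  ∀ m t, P[R.noise m t | R.hist t] =ᵐ[P] 0 ∧
    ∀ a : ℝ, Integrable (fun ω => Real.exp (a * R.noise m t ω)) P ∧
      P[fun ω => Real.exp (a * R.noise m t ω) | R.hist t] ≤ᵐ[P]
        fun ω => Real.exp (a ^ 2 * τ m (R.x t ω, R.w t ω) ^ 2 / 2)

/-- Uncontrollable environment: `w_{t+1}` is drawn from `Pw x_{t+1}`, given all that is known
(`𝒢 t`) once `x_{t+1}` has been selected. -/
def Run.SamplesEnv (R : Run S X W M) (P : Measure S) (Pw : Kernel X W) : Prop :=
  ∃ 𝒢 : ℕ → MeasurableSpace S, (∀ t, 𝒢 t ≤ R.hist t) ∧ (∀ t, R.hist t ≤ 𝒢 (t + 1)) ∧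
    (∀ m t, Measurable[𝒢 (t + 1)] (R.noise m t)) ∧ (∀ t, Measurable[𝒢 t] (R.x t)) ∧
    ∀ t (A : Set W), MeasurableSet A →
      P[(R.w t ⁻¹' A).indicator (fun _ => (1 : ℝ)) | 𝒢 t] =ᵐ[P] fun ω => (Pw (R.x t ω)).real A

/-- The computed quantities: after `t` observations, the vectors `LCB_t(x)`, `UCB_t(x)` of bounds
for the risk measures and the set of estimated Pareto solutions.  They may depend on the data and on
auxiliary randomness. -/
structure Estimates (S X ι : Type*) where
  lcb : ℕ → S → X → ι → ℝ
  ucb : ℕ → S → X → ι → ℝ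
  sol : ℕ → S → Set X

variable {ι : Type*} [Fintype ι]

/-- The acquisition function `a_t^{(𝒳)}(x) = dist (UCB_t(x), Dom (LCB_t(Π̂_t)))`. -/
def Estimates.acq (E : Estimates S X ι) (t : ℕ) (ω : S) (x : X) : ℝ≥0∞ :=
  Metric.infEDist (E.ucb t ω x) (Dom (E.lcb t ω '' E.sol t ω))

/-- The error inequality for the bounds, with `G t x j` the functions compatible with the credible
interval of the black-box function underlying the `j`-th risk measure. -/
def Estimates.BoundErr (E : Estimates S X ι) (ρ : X → ι → RiskMeasure W)
    (G : ℕ → X → ι → Set (W → ℝ)) (ω : S) (εlcb εucb : ℝ) : Prop :=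
  ∀ t x j, ∀ g ∈ G t x j,
    E.lcb t ω x j - εlcb ≤ (ρ x j).val g ∧ (ρ x j).val g ≤ E.ucb t ω x j + εucb

/-- The set of estimated Pareto solutions is an approximate solution of the problem of finding the
Pareto front of `LCB_t`: its members are (weakly) non-dominated among each other with respect to
`LCB_t`, and the front that it generates is within `εPF` of the front of `LCB_t`. -/
def Estimates.FrontErr (E : Estimates S X ι) (ω : S) (εPF : ℝ) : Prop :=
  ∀ t, E.lcb t ω '' E.sol t ω ⊆ Par (E.lcb t ω '' E.sol t ω) ∧
    maxDist (Par (E.lcb t ω '' E.sol t ω)) (Par (Set.range (E.lcb t ω))) ≤ ENNReal.ofReal εPF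

/-- The error inequality for the maximisation of `a_t^{(𝒳)}`. -/
def Estimates.AcqErr (E : Estimates S X ι) (R : Run S X W M) (ω : S) (εX : ℝ) : Prop :=
  ∀ t, (⨆ x, E.acq t ω x) ≤ E.acq t ω (R.x t ω) + ENNReal.ofReal εX

/-- The error inequality for the maximisation over `Ωx x_{t+1}` of
`a_t^{(Ω)}(w) = ∑ m, 2 β_{m,t+1}^{1/2} σ_t^{(m)}(x_{t+1}, w)`;
`b m t` is `β_{m,t+1}^{1/2}` and `σ m t` is `σ_t^{(m)}`. -/
def Run.EnvErr (R : Run S X W M) (Ωx : X → Set W) (b : Fin M → ℕ → ℝ)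
    (σ : Fin M → ℕ → X × W → ℝ) (ω : S) (εΩ : ℝ) : Prop :=
  ∀ t, ∀ w ∈ Ωx (R.x t ω), ∑ m, 2 * b m t * σ m t (R.x t ω, w)
    - ∑ m, 2 * b m t * σ m t (R.x t ω, R.w t ω) ≤ εΩ

/-- With probability at least `1 - δ`, for all `t` the inference discrepancy is at most
`a_t^{(𝒳)}(x_{t+1}) + c`, and hence at most `ε + c` at every `T` at which the stopping condition
`a_T^{(𝒳)}(x_{T+1}) ≤ ε` holds. -/
def Guarantee (P : Measure S) (R : Run S X W M) (E : Estimates S X ι) (F : X → ι → ℝ)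
    (δ ε c : ℝ) : Prop :=
  ∃ A, MeasurableSet A ∧ ENNReal.ofReal (1 - δ) ≤ P A ∧ ∀ ω ∈ A,
    (∀ t, discrepancy F (E.sol t ω) ≤ E.acq t ω (R.x t ω) + ENNReal.ofReal c) ∧
    ∀ T, E.acq T ω (R.x T ω) ≤ ENNReal.ofReal ε →
      discrepancy F (E.sol T ω) ≤ ENNReal.ofReal (ε + c)

end Run

/-! ### The two observation models

In both, `t` counts the observations made so far, and the band at `t` uses `β_{m,t+1}`. -/

section Models

variable {S X W : Type*} [MeasurableSpace S] [MeasurableSpace X] [MeasurableSpace W] {M : ℕ}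

/-- `μ_t^{(m)}`, homoscedastic Gaussian noise of standard deviation `s m`. -/
def gMean (k : Fin M → X × W → X × W → ℝ) (f : Fin M → X × W → ℝ) (s : Fin M → ℝ)
    (R : Run S X W M) (ω : S) (m : Fin M) (t : ℕ) : X × W → ℝ :=
  postMean (k m) (R.pts t ω) (fun _ => s m ^ 2) (R.obs (f m) m t ω)

/-- `σ_t^{(m)}`, homoscedastic Gaussian noise. -/
def gSd (k : Fin M → X × W → X × W → ℝ) (s : Fin M → ℝ)
    (R : Run S X W M) (ω : S) (m : Fin M) (t : ℕ) : X × W → ℝ :=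
  postSd (k m) (R.pts t ω) (fun _ => s m ^ 2)

/-- `β_{m,t+1}^{1/2}`, homoscedastic Gaussian noise. -/
def gBeta (k : Fin M → X × W → X × W → ℝ) (B s : Fin M → ℝ) (δ : ℝ) (m : Fin M) (t : ℕ) : ℝ :=
  betaGauss (k m) (B m) (s m) δ M (t + 1)

/-- The noise variances of the first `n` observations of `f^{(m)}`. -/
def vars (τ : Fin M → X × W → ℝ) (R : Run S X W M) (ω : S) (m : Fin M) (n : ℕ) : Fin n → ℝ :=
  fun i => τ m (R.pts n ω i) ^ 2

/-- `μ_t^{(m)}`, heteroscedastic noise, prior covariance `k m / lam m`. -/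
def hMean (k : Fin M → X × W → X × W → ℝ) (f : Fin M → X × W → ℝ) (lam : Fin M → ℝ)
    (τ : Fin M → X × W → ℝ) (R : Run S X W M) (ω : S) (m : Fin M) (t : ℕ) : X × W → ℝ :=
  postMean (fun p q => 1 / lam m * k m p q) (R.pts t ω) (vars τ R ω m t) (R.obs (f m) m t ω)

/-- `σ_t^{(m)}`, heteroscedastic noise, prior covariance `k m / lam m`. -/
def hSd (k : Fin M → X × W → X × W → ℝ) (lam : Fin M → ℝ)
    (τ : Fin M → X × W → ℝ) (R : Run S X W M) (ω : S) (m : Fin M) (t : ℕ) : X × W → ℝ :=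
  postSd (fun p q => 1 / lam m * k m p q) (R.pts t ω) (vars τ R ω m t)

/-- `β_{m,t+1}^{1/2}`, heteroscedastic noise, formed from the first `t + r` query points.
`r = 1` is the convention in which `β_{m,n}` is formed from `n` points; `r = 0` uses only the
points that have been queried when the bounds of step `t` are computed. -/
def hBeta (k : Fin M → X × W → X × W → ℝ) (B lam : Fin M → ℝ) (δ : ℝ)
    (τ : Fin M → X × W → ℝ) (r : ℕ) (R : Run S X W M) (ω : S) (m : Fin M) (t : ℕ) : ℝ :=
  betaSubG (k m) (B m) (lam m) δ M (R.pts (t + r) ω) (vars τ R ω m (t + r))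

end Models

end

end ParetoBO

namespace ParetoBO

noncomputable section

/-! ### Geometry of dominated regions -/

section Geometry

variable {X ι : Type*}

/-! The argument combines a deterministic comparison of fronts with a single probabilistic event.

Deterministic part (`discrepancy_le`). Suppose that `F x` lies between `L x - εl` and `U x + εu` at
every `x`, and that the acquisition value is at most `a` everywhere. Then every `U x` is dominated,
up to `a`, by `L x'` for some estimated solution `x'`. So a point of the true front, lowered along
the diagonal by slightly more than `a + εl + εu`, is dominated by the values of the estimated
solutions. Conversely, if the value of an estimated solution could be raised by more than this
amount and remain dominated by `F`, its `L`-value would be interior to the region dominated by the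
estimated solutions, against mutual non-domination. A diagonal segment leaving a dominated region
meets its boundary (`infEDist_Par_le`), which turns both facts into sup-distance bounds.

Probabilistic part (`exists_uniform_band`). Let K be the Gram matrix, V the diagonal noise
covariance and η the noise vector. At all points simultaneously, the regression error is at most the
RKHS norm plus the square root of ηᵀ(V⁻¹ - (K + V)⁻¹)η, times the posterior standard deviation
(`abs_sub_postMean_le`). Half of that quadratic form is the exponent of the likelihood ratio of N(0,
K + V) against N(0, V) at η, whose prefactor is (det(K + V) / det V)^(-1/2). Even for adaptive
queries this ratio is a nonnegative supermartingale started at 1: its step factor is a Gaussian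
mixture of terms exp(aη - a²v/2), each of conditional mean at most 1. Ville's inequality at level
M/δ and a union bound over the M functions give bands valid at all times.

These bands use the determinant ratio of the points already observed. Adding points increases it,
and for Gaussian noise its logarithm is bounded by the information gain, so the radii do not exceed
those built from β. The risk bounds therefore apply to the true functions and supply the sandwich
for `F`. -/

theorem isLowerSet_Dom (B : Set (ι → ℝ)) : IsLowerSet (Dom B) :=
  fun _ _ hab ⟨s, hs, has⟩ => ⟨s, hs, hab.trans has⟩

theorem mem_interior_Dom [Fintype ι] {B : Set (ι → ℝ)} {y : ι → ℝ} {η : ℝ} (hη : 0 < η)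
    (h : (fun j => y j + η) ∈ Dom B) : y ∈ interior (Dom B) := by
  rw [mem_interior_iff_mem_nhds]
  filter_upwards [Metric.ball_mem_nhds y hη] with z hz
  refine isLowerSet_Dom B (fun j => ?_) h
  have h1 := (dist_le_pi_dist z y j).trans_lt (Metric.mem_ball.1 hz)
  rw [Real.dist_eq] at h1
  linarith [(abs_lt.1 h1).2]

theorem sub_mem_Dom_of_mem_closure [Fintype ι] {B : Set (ι → ℝ)} {y : ι → ℝ} {η : ℝ} (hη : 0 < η)
    (h : y ∈ closure (Dom B)) : (fun j => y j - η) ∈ Dom B := by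
  obtain ⟨z, hz, hyz⟩ := Metric.mem_closure_iff.1 h η hη
  refine isLowerSet_Dom B (fun j => ?_) hz
  have h1 := (dist_le_pi_dist y z j).trans_lt hyz
  rw [Real.dist_eq] at h1
  linarith [(abs_lt.1 h1).2]

/-- A diagonal segment that leaves the dominated region crosses the Pareto front. -/
theorem infEDist_Par_le [Fintype ι] {B : Set (ι → ℝ)} {y : ι → ℝ} {r : ℝ}
    (hin : (fun j => y j - r) ∈ Dom B) (hout : (fun j => y j + r) ∉ Dom B) :
    Metric.infEDist y (Par B) ≤ ENNReal.ofReal r := by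
  set γ : ℝ → ι → ℝ := fun s j => y j + s with hγ
  have hγc : Continuous γ := by fun_prop
  have hmono : ∀ s s', s ≤ s' → γ s' ∈ Dom B → γ s ∈ Dom B := fun s s' hss h =>
    isLowerSet_Dom B (fun j => by simp only [hγ]; linarith) h
  have hin' : γ (-r) ∈ Dom B := by simpa only [hγ, ← sub_eq_add_neg] using hin
  -- The parameters whose point on the diagonal line is dominated form a lower set of ℝ, neither
  -- empty nor everything, so connectedness gives a frontier point. Continuity carries it to the
  -- Pareto front, and monotonicity places it in `[-r, r]`.
  obtain ⟨s, hs⟩ : (frontier (γ ⁻¹' Dom B)).Nonempty :=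
    nonempty_frontier_iff.2 ⟨⟨-r, hin'⟩, fun h => hout (h ▸ Set.mem_univ r : r ∈ γ ⁻¹' Dom B)⟩
  have h1 : -r ≤ s := by
    by_contra! hlt
    refine hs.2 (mem_interior_iff_mem_nhds.2 ?_)
    filter_upwards [Iio_mem_nhds hlt] with u hu
    exact hmono u (-r) (le_of_lt hu) hin'
  have h2 : s ≤ r := by
    by_contra! hlt
    obtain ⟨u, hu, hu'⟩ := mem_closure_iff_nhds.1 hs.1 _ (Ioi_mem_nhds hlt)
    exact hout (hmono r u (le_of_lt hu) hu')
  have hr : 0 ≤ r := by linarith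
  have hmem : γ s ∈ Par B := hγc.frontier_preimage_subset _ hs
  refine (Metric.infEDist_le_edist_of_mem hmem).trans ?_
  rw [edist_dist]
  refine ENNReal.ofReal_le_ofReal ((dist_pi_le_iff hr).2 fun j => ?_)
  rw [Real.dist_eq, abs_le]
  constructor <;> simp only [hγ] <;> linarith

/-- The inference discrepancy is controlled by the largest value of the acquisition function. -/
theorem discrepancy_le [Fintype ι] {F L U : X → ι → ℝ} {E : Set X} {a : ℝ≥0∞} {εl εu : ℝ}
    (hεl : 0 ≤ εl) (hεu : 0 ≤ εu)
    (hL : ∀ x j, L x j - εl ≤ F x j) (hU : ∀ x j, F x j ≤ U x j + εu)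
    (hnd : L '' E ⊆ Par (L '' E)) (ha : ∀ x, Metric.infEDist (U x) (Dom (L '' E)) ≤ a) :
    discrepancy F E ≤ a + ENNReal.ofReal (εl + εu) := by
  rcases eq_or_ne a ∞ with rfl | hfin
  · simp
  lift a to NNReal using hfin
  have hsum : (a : ℝ≥0∞) + ENNReal.ofReal (εl + εu) = ENNReal.ofReal (a + (εl + εu)) := by
    rw [ENNReal.ofReal_add a.coe_nonneg (by positivity), ENNReal.ofReal_coe_nnreal]
  -- The slack `η` is needed because the infimum defining the distance need not be attained; it is
  -- removed at the end by `lim`.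
  have key : ∀ x, ∀ η : ℝ, 0 < η → ∃ x' ∈ E, ∀ j, U x j ≤ L x' j + a + η := by
    intro x η hη
    have hlt : Metric.infEDist (U x) (Dom (L '' E)) < a + ENNReal.ofReal η :=
      (ha x).trans_lt (ENNReal.lt_add_right ENNReal.coe_ne_top (by simpa using hη))
    obtain ⟨y, ⟨_, ⟨x', hx', rfl⟩, hy⟩, hd⟩ := Metric.infEDist_lt_iff.1 hlt
    refine ⟨x', hx', fun j => ?_⟩
    rw [← ENNReal.ofReal_coe_nnreal, ← ENNReal.ofReal_add a.coe_nonneg hη.le, edist_dist] at hd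
    have h1 := (dist_le_pi_dist (U x) y j).trans
      ((ENNReal.ofReal_lt_ofReal_iff (by positivity)).1 hd).le
    rw [Real.dist_eq] at h1
    linarith [(abs_le.1 h1).2, hy j]
  set c : ℝ := a + (εl + εu) with hc
  have hc0 : 0 ≤ c := by positivity
  have hsub : Dom (F '' E) ⊆ Dom (Set.range F) := fun s ⟨s', hs', h⟩ =>
    ⟨s', Set.image_subset_range _ _ hs', h⟩
  rw [hsum]
  have lim : ∀ y (B : Set (ι → ℝ)), (∀ η : ℝ, 0 < η → Metric.infEDist y B ≤ ENNReal.ofReal (c + η))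
      → Metric.infEDist y B ≤ ENNReal.ofReal c := by
    intro y B h
    refine ENNReal.le_of_forall_pos_le_add fun η hη _ => (h η hη).trans ?_
    rw [ENNReal.ofReal_add hc0 η.coe_nonneg, ENNReal.ofReal_coe_nnreal]
  refine max_le (iSup₂_le fun y hy => lim _ _ fun η hη => infEDist_Par_le ?_ ?_)
    (iSup₂_le ?_)
  · obtain ⟨_, ⟨x, rfl⟩, hx⟩ := sub_mem_Dom_of_mem_closure (half_pos hη) hy.1
    obtain ⟨x', hx', h⟩ := key x (η / 2) (half_pos hη)
    refine ⟨F x', ⟨x', hx', rfl⟩, fun j => ?_⟩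
    have h1 := hx j
    simp only at h1 ⊢
    linarith [h j, hU x j, hL x' j]
  · exact fun h => hy.2 (mem_interior_Dom (by positivity) (hsub h))
  · rintro _ ⟨x, hx, rfl⟩
    refine lim _ _ fun η hη => infEDist_Par_le ?_ ?_
    · exact ⟨F x, ⟨x, rfl⟩, fun j => by simp only; linarith⟩
    · rintro ⟨_, ⟨x₁, rfl⟩, h₁⟩
      obtain ⟨x', hx', h⟩ := key x₁ (η / 2) (half_pos hη)
      -- A point dominating `F x + c + η` would make `L x'` exceed `L x` by `η / 2` in every
      -- coordinate, so `L x` would not be on the front of `L '' E`.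
      refine (hnd ⟨x, hx, rfl⟩).2 (mem_interior_Dom (half_pos hη) ⟨L x', ⟨x', hx', rfl⟩, ?_⟩)
      intro j
      have h2 := h₁ j
      simp only at h2 ⊢
      linarith [h j, hU x₁ j, hL x j]

end Geometry

/-! ### Regularised Gram matrices -/

section Gram

variable {Z : Type*} {k : Z → Z → ℝ}

theorem posSemidef_gram (hk : (Matrix.of k).PosSemidef) {n : ℕ} (z : Fin n → Z) :
    (gram k z).PosSemidef := hk.submatrix z

theorem posDef_gram_add_diagonal (hk : (Matrix.of k).PosSemidef) {n : ℕ} (z : Fin n → Z)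
    {v : Fin n → ℝ} (hv : ∀ i, 0 < v i) : (gram k z + Matrix.diagonal v).PosDef :=
  Matrix.PosDef.posSemidef_add (posSemidef_gram hk z) (Matrix.PosDef.diagonal hv)

theorem kernel_symm (hk : (Matrix.of k).PosSemidef) (p q : Z) : k p q = k q p := by
  simpa using hk.isHermitian.apply q p

/-- The posterior variance, of which `postSd` is the square root. -/
def postVar (k : Z → Z → ℝ) {n : ℕ} (z : Fin n → Z) (v : Fin n → ℝ) (p : Z) : ℝ :=
  k p p - (fun i => k p (z i)) ⬝ᵥ ((gram k z + Matrix.diagonal v)⁻¹ *ᵥ fun i => k p (z i))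

/-- The weights with which the posterior mean at `p` combines the observations. -/
def postWeights (k : Z → Z → ℝ) {n : ℕ} (z : Fin n → Z) (v : Fin n → ℝ) (p : Z) : Fin n → ℝ :=
  (gram k z + Matrix.diagonal v)⁻¹ *ᵥ fun i => k p (z i)

theorem postVar_eq {n : ℕ} (z : Fin n → Z) (v : Fin n → ℝ) (p : Z) :
    postVar k z v p = k p p - (fun i => k p (z i)) ⬝ᵥ postWeights k z v p := rfl

theorem postMean_eq_dotProduct (hk : (Matrix.of k).PosSemidef) {n : ℕ} (z : Fin n → Z)
    {v : Fin n → ℝ} (hv : ∀ i, 0 < v i) (y : Fin n → ℝ) (p : Z) :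
    postMean k z v y p = y ⬝ᵥ postWeights k z v p := by
  have hsymm := (posDef_gram_add_diagonal hk z hv).isHermitian.inv
  unfold postMean postWeights
  rw [Matrix.dotProduct_mulVec, dotProduct_comm, ← Matrix.mulVec_transpose]
  congr 2

theorem mulVec_postWeights (hk : (Matrix.of k).PosSemidef) {n : ℕ} (z : Fin n → Z)
    {v : Fin n → ℝ} (hv : ∀ i, 0 < v i) (p : Z) :
    (gram k z + Matrix.diagonal v) *ᵥ postWeights k z v p = fun i => k p (z i) := by
  have hdet := (posDef_gram_add_diagonal hk z hv).det_pos.ne'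
  rw [postWeights, Matrix.mulVec_mulVec, Matrix.mul_nonsing_inv _ (isUnit_iff_ne_zero.2 hdet),
    Matrix.one_mulVec]

theorem postVar_le (hk : (Matrix.of k).PosSemidef) {n : ℕ} (z : Fin n → Z)
    {v : Fin n → ℝ} (hv : ∀ i, 0 < v i) (p : Z) : postVar k z v p ≤ k p p := by
  have h := (posDef_gram_add_diagonal hk z hv).inv.posSemidef.dotProduct_mulVec_nonneg
    (fun i => k p (z i))
  simp only [star_trivial] at h
  unfold postVar
  linarith

/-- The determinant ratio `det (K + V) / det V`. -/
def detRatio (k : Z → Z → ℝ) {n : ℕ} (z : Fin n → Z) (v : Fin n → ℝ) : ℝ :=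
  (gram k z + Matrix.diagonal v).det / ∏ i, v i

/-- The quadratic form `yᵀ (V⁻¹ - (K + V)⁻¹) y`. -/
def noiseForm (k : Z → Z → ℝ) {n : ℕ} (z : Fin n → Z) (v y : Fin n → ℝ) : ℝ :=
  ∑ i, y i ^ 2 / v i - y ⬝ᵥ ((gram k z + Matrix.diagonal v)⁻¹ *ᵥ y)

theorem detRatio_pos (hk : (Matrix.of k).PosSemidef) {n : ℕ} (z : Fin n → Z)
    {v : Fin n → ℝ} (hv : ∀ i, 0 < v i) : 0 < detRatio k z v :=
  div_pos (posDef_gram_add_diagonal hk z hv).det_pos (Finset.prod_pos fun i _ => hv i)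

/-- The second factor is the Schur complement of the block belonging to the first `n` points. -/
theorem det_gram_succ (hk : (Matrix.of k).PosSemidef) {n : ℕ} (z : Fin (n + 1) → Z)
    {v : Fin (n + 1) → ℝ} (hv : ∀ i, 0 < v i) :
    (gram k z + Matrix.diagonal v).det =
      (gram k (z ∘ Fin.castSucc) + Matrix.diagonal (v ∘ Fin.castSucc)).det *
        (postVar k (z ∘ Fin.castSucc) (v ∘ Fin.castSucc) (z (Fin.last n)) + v (Fin.last n)) := by
  set A := gram k (z ∘ Fin.castSucc) + Matrix.diagonal (v ∘ Fin.castSucc) with hA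
  have hdet : A.det ≠ 0 :=
    (posDef_gram_add_diagonal hk (z ∘ Fin.castSucc) fun i => hv i.castSucc).det_pos.ne'
  let _ : Invertible A := A.invertibleOfIsUnitDet (isUnit_iff_ne_zero.2 hdet)
  have hblock : (gram k z + Matrix.diagonal v).submatrix finSumFinEquiv finSumFinEquiv =
      Matrix.fromBlocks A
        (Matrix.of fun i (_ : Fin 1) => k (z (Fin.last n)) (z i.castSucc))
        (Matrix.of fun (_ : Fin 1) i => k (z (Fin.last n)) (z i.castSucc))
        (Matrix.of fun _ _ => k (z (Fin.last n)) (z (Fin.last n)) + v (Fin.last n)) := by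
    ext (i | i) (j | j)
    · simp [hA, gram, Matrix.diagonal_apply, Fin.ext_iff, Fin.castSucc, Fin.castAdd, Fin.castLE]
    · have h1 : (Fin.natAdd n j : Fin (n + 1)) = Fin.last n := by ext; simp
      have h2 : (Fin.castAdd 1 i : Fin (n + 1)) = i.castSucc := rfl
      simp [gram, h1, h2, (Fin.castSucc_lt_last i).ne,
        kernel_symm hk (z i.castSucc)]
    · have h1 : (Fin.natAdd n i : Fin (n + 1)) = Fin.last n := by ext; simp
      have h2 : (Fin.castAdd 1 j : Fin (n + 1)) = j.castSucc := rfl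
      simp [gram, h1, h2, (Fin.castSucc_lt_last j).ne']
    · have h1 : ∀ i : Fin 1, (Fin.natAdd n i : Fin (n + 1)) = Fin.last n := fun i => by ext; simp
      simp [gram, h1]
  rw [← Matrix.det_submatrix_equiv_self finSumFinEquiv, hblock, Matrix.det_fromBlocks₁₁]
  congr 1
  rw [Matrix.det_unique, Matrix.invOf_eq_nonsing_inv, Matrix.mul_assoc]
  simp only [postVar, Matrix.sub_apply, Matrix.of_apply, Matrix.mul_apply, dotProduct,
    Matrix.mulVec, Function.comp, ← hA]
  ring_nf

/-- Append `p` as a further query with noise variance `ε`. Both regularised determinants are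
positive, hence so is their quotient `postVar + ε`; then `ε` is arbitrary. -/
theorem postVar_nonneg (hk : (Matrix.of k).PosSemidef) {n : ℕ} (z : Fin n → Z)
    {v : Fin n → ℝ} (hv : ∀ i, 0 < v i) (p : Z) : 0 ≤ postVar k z v p := by
  refine le_of_forall_pos_lt_add fun ε hε => ?_
  have hz : (Fin.snoc z p : Fin (n + 1) → Z) ∘ Fin.castSucc = z := by ext; simp
  have hv' : (Fin.snoc v ε : Fin (n + 1) → ℝ) ∘ Fin.castSucc = v := by ext; simp
  have hpos : ∀ i, 0 < (Fin.snoc v ε : Fin (n + 1) → ℝ) i :=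
    Fin.lastCases (by simpa using hε) fun i => by simpa using hv i
  have h := det_gram_succ hk (Fin.snoc z p) hpos
  rw [hz, hv', Fin.snoc_last, Fin.snoc_last] at h
  have h1 := (posDef_gram_add_diagonal hk (Fin.snoc z p) hpos).det_pos
  rw [h] at h1
  exact pos_of_mul_pos_right h1 (posDef_gram_add_diagonal hk z hv).det_pos.le

theorem detRatio_succ (hk : (Matrix.of k).PosSemidef) {n : ℕ} (z : Fin (n + 1) → Z)
    {v : Fin (n + 1) → ℝ} (hv : ∀ i, 0 < v i) :
    detRatio k z v = detRatio k (z ∘ Fin.castSucc) (v ∘ Fin.castSucc) *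
      (1 + postVar k (z ∘ Fin.castSucc) (v ∘ Fin.castSucc) (z (Fin.last n)) / v (Fin.last n)) := by
  unfold detRatio
  rw [det_gram_succ hk z hv, Fin.prod_univ_castSucc]
  have h1 := (hv (Fin.last n)).ne'
  have h2 : ∏ i : Fin n, v i.castSucc ≠ 0 := (Finset.prod_pos fun i _ => hv i.castSucc).ne'
  simp only [Function.comp]
  field_simp
  ring

/-- This is the factorisation of a Gaussian density into the past and the last coordinate given the
past: under N(0, K + V) the latter has mean `postMean` and variance `postVar + v`, under N(0, V)
mean 0 and variance `v`. -/
theorem noiseForm_succ (hk : (Matrix.of k).PosSemidef) {n : ℕ} (z : Fin (n + 1) → Z)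
    {v : Fin (n + 1) → ℝ} (hv : ∀ i, 0 < v i) (y : Fin (n + 1) → ℝ) :
    noiseForm k z v y =
      noiseForm k (z ∘ Fin.castSucc) (v ∘ Fin.castSucc) (y ∘ Fin.castSucc) +
      (y (Fin.last n) ^ 2 / v (Fin.last n) -
        (y (Fin.last n) - postMean k (z ∘ Fin.castSucc) (v ∘ Fin.castSucc) (y ∘ Fin.castSucc)
          (z (Fin.last n))) ^ 2 /
        (postVar k (z ∘ Fin.castSucc) (v ∘ Fin.castSucc) (z (Fin.last n)) + v (Fin.last n))) := by
  set z' := z ∘ Fin.castSucc with hz'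
  set v' := v ∘ Fin.castSucc with hv'
  set y' := y ∘ Fin.castSucc with hy'
  have hv'0 : ∀ i, 0 < v' i := fun i => hv i.castSucc
  set p := z (Fin.last n) with hp
  set s := postVar k z' v' p + v (Fin.last n) with hs'
  set A := gram k z' + Matrix.diagonal v' with hA
  set α := postWeights k z' v' p with hα
  set m := postMean k z' v' y' p with hm
  -- Block elimination: `g` is the last coordinate of the solution of the enlarged system, the
  -- prediction residual over the Schur complement, and `c'` is the old solution corrected by `g`.
  set g := (y (Fin.last n) - m) / s with hg
  set c' : Fin n → ℝ := A⁻¹ *ᵥ y' - g • α with hc'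
  set c : Fin (n + 1) → ℝ := Fin.snoc c' g with hc
  have hAdet := (posDef_gram_add_diagonal hk z' hv'0).det_pos.ne'
  have hAα : A *ᵥ α = fun i => k p (z' i) := mulVec_postWeights hk z' hv'0 p
  have hAc : A *ᵥ c' = y' - g • fun i => k p (z' i) := by
    rw [hc', Matrix.mulVec_sub, Matrix.mulVec_smul, hAα, Matrix.mulVec_mulVec,
      Matrix.mul_nonsing_inv _ (isUnit_iff_ne_zero.2 hAdet), Matrix.one_mulVec]
  have hβc : (fun i => k p (z' i)) ⬝ᵥ c' = m - g * (k p p - postVar k z' v' p) := by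
    rw [hc', dotProduct_sub, dotProduct_smul, postVar_eq, ← hα, hm, postMean, smul_eq_mul]
    ring
  have hs : 0 < s := add_pos_of_nonneg_of_pos (postVar_nonneg hk z' hv'0 p) (hv _)
  have hgs : g * s = y (Fin.last n) - m := div_mul_cancel₀ _ hs.ne'
  have hsolve : (gram k z + Matrix.diagonal v) *ᵥ c = y := by
    ext i
    refine Fin.lastCases ?_ (fun i => ?_) i
    · have : (gram k z + Matrix.diagonal v) (Fin.last n) ⬝ᵥ c =
          (fun i => k p (z' i)) ⬝ᵥ c' + (k p p + v (Fin.last n)) * g := by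
        simp only [dotProduct, Fin.sum_univ_castSucc, hc, Fin.snoc_castSucc, Fin.snoc_last]
        simp [gram, (Fin.castSucc_lt_last _).ne', hz', hp]
      rw [Matrix.mulVec, this, hβc]
      linear_combination hgs
    · have : (gram k z + Matrix.diagonal v) i.castSucc ⬝ᵥ c = (A *ᵥ c') i + k p (z' i) * g := by
        simp only [Matrix.mulVec, dotProduct, Fin.sum_univ_castSucc, hc, Fin.snoc_castSucc,
          Fin.snoc_last]
        congr 1
        · refine Finset.sum_congr rfl fun j _ => ?_
          simp [hA, gram, Matrix.diagonal_apply, hz', hv']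
        · simp [gram, (Fin.castSucc_lt_last _).ne, hz', hp,
            kernel_symm hk (z i.castSucc)]
      rw [Matrix.mulVec, this, hAc]
      simp [hy']
      ring
  have hdet := (posDef_gram_add_diagonal hk z hv).det_pos.ne'
  have hinv : (gram k z + Matrix.diagonal v)⁻¹ *ᵥ y = c := by
    rw [← hsolve, Matrix.mulVec_mulVec, Matrix.nonsing_inv_mul _ (isUnit_iff_ne_zero.2 hdet),
      Matrix.one_mulVec]
  have hyα : y' ⬝ᵥ α = m := (postMean_eq_dotProduct hk z' hv'0 y' p).symm
  have hyc : y ⬝ᵥ c = y' ⬝ᵥ (A⁻¹ *ᵥ y') - g * m + y (Fin.last n) * g := by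
    have : y ⬝ᵥ c = y' ⬝ᵥ c' + y (Fin.last n) * g := by
      simp only [dotProduct, Fin.sum_univ_castSucc, hc, Fin.snoc_castSucc, Fin.snoc_last]
      rfl
    rw [this, hc', dotProduct_sub, dotProduct_smul, hyα, smul_eq_mul]
  have hlast : (y (Fin.last n) - m) ^ 2 / s = g * (y (Fin.last n) - m) := by
    rw [hg]; ring
  rw [noiseForm, noiseForm, hinv, hyc, Fin.sum_univ_castSucc, hlast]
  simp only [hy', hv', Function.comp]
  ring

end Gram

/-! ### Pointwise confidence bands in a reproducing kernel Hilbert space -/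

section Band

open scoped InnerProductSpace

/-- Kernel sections evaluated at the scalar 1 serve as features, so the sequel only needs an inner
product space and a feature map. -/
theorem InRKHSBall.exists_feature {Z : Type} {k : Z → Z → ℝ} {B : ℝ} {f : Z → ℝ}
    (hf : InRKHSBall k B f) :
    ∃ (H : Type) (_ : NormedAddCommGroup H) (_ : InnerProductSpace ℝ H) (φ : Z → H) (h : H),
      (∀ p q, ⟪φ p, φ q⟫_ℝ = k p q) ∧ (∀ p, f p = ⟪h, φ p⟫_ℝ) ∧ ‖h‖ ≤ B := by
  obtain ⟨H, _, _, _, _, hk, h, rfl, hB⟩ := hf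
  refine ⟨H, inferInstance, inferInstance, fun p => RKHS.kerFun H p 1, h, fun p q => ?_,
    fun p => ?_, hB⟩
  · rw [← hk, RKHS.inner_kerFun, RKHS.kerFun_apply]
    have hsymm := congrFun (congrArg DFunLike.coe ((RKHS.isHermitian_kernel H).apply q p)) (1 : ℝ)
    have h1 := RKHS.kernel_inner H p q (1 : ℝ) (1 : ℝ)
    have h2 := RKHS.kernel_inner H q p (1 : ℝ) (1 : ℝ)
    simp only [RKHS.kerFun_inner, RKHS.kerFun_apply] at h1 h2
    simp at h1 h2 ⊢
    linarith
  · simp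

variable {Z H : Type*} {k : Z → Z → ℝ} [NormedAddCommGroup H] [InnerProductSpace ℝ H]

theorem norm_sq_sum_feature {φ : Z → H} (hφ : ∀ p q, ⟪φ p, φ q⟫_ℝ = k p q) {n : ℕ}
    (z : Fin n → Z) (c : Fin n → ℝ) :
    ‖∑ i, c i • φ (z i)‖ ^ 2 = c ⬝ᵥ (gram k z *ᵥ c) := by
  rw [← real_inner_self_eq_norm_sq, sum_inner]
  simp only [dotProduct, Matrix.mulVec, inner_sum, real_inner_smul_left, real_inner_smul_right, hφ,
    gram, Matrix.of_apply]
  exact Finset.sum_congr rfl fun i _ => by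
    rw [Finset.mul_sum]
    exact Finset.sum_congr rfl fun j _ => by ring

/-- Cauchy–Schwarz in an orthogonal sum of two spaces, given its form in each summand. -/
theorem add_mul_le_sqrt_mul_sqrt {x y N G R T : ℝ} (hR : 0 ≤ R) (hT : 0 ≤ T)
    (hx : |x| ≤ N * G) (hy : y ^ 2 ≤ R * T) :
    |x + y| ≤ √(N ^ 2 + R) * √(G ^ 2 + T) := by
  rw [← Real.sqrt_mul (by positivity)]
  apply Real.abs_le_sqrt
  have hx2 : x ^ 2 ≤ N ^ 2 * G ^ 2 := by
    rw [← mul_pow, ← sq_abs]; exact pow_le_pow_left₀ (abs_nonneg _) hx 2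
  have h : |2 * (x * y)| ≤ N ^ 2 * T + R * G ^ 2 := by
    refine abs_le_of_sq_le_sq ?_ (by positivity)
    have h1 : x ^ 2 * y ^ 2 ≤ (N ^ 2 * G ^ 2) * (R * T) :=
      mul_le_mul hx2 hy (sq_nonneg _) (by positivity)
    nlinarith [sq_nonneg (N ^ 2 * T - R * G ^ 2)]
  nlinarith [le_abs_self (2 * (x * y))]

/-- Confidence band for a function in the RKHS from a bound on its norm and on the self-normalised
noise. -/
theorem abs_sub_postMean_le {φ : Z → H} (hφ : ∀ p q, ⟪φ p, φ q⟫_ℝ = k p q)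
    (hk : (Matrix.of k).PosSemidef) {n : ℕ} (z : Fin n → Z) {v : Fin n → ℝ} (hv : ∀ i, 0 < v i)
    (h : H) (η : Fin n → ℝ) (p : Z) :
    |⟪h, φ p⟫_ℝ - postMean k z v (fun i => ⟪h, φ (z i)⟫_ℝ + η i) p| ≤
      (‖h‖ + √(noiseForm k z v η)) * √(postVar k z v p) := by
  set A := gram k z + Matrix.diagonal v with hA
  set α := postWeights k z v p with hα
  set β : Fin n → ℝ := fun i => k p (z i) with hβ
  set g : H := φ p - ∑ i, α i • φ (z i) with hg
  have hAdet := (posDef_gram_add_diagonal hk z hv).det_pos.ne'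
  have hgram : ∀ c : Fin n → ℝ, gram k z *ᵥ c = A *ᵥ c - fun i => v i * c i := fun c => by
    rw [hA, Matrix.add_mulVec]
    ext i
    simp [Matrix.mulVec_diagonal]
  have hinner : ∀ u : H, ⟪u, g⟫_ℝ = ⟪u, φ p⟫_ℝ - ∑ i, α i * ⟪u, φ (z i)⟫_ℝ := fun u => by
    simp only [hg, inner_sub_right, inner_sum, real_inner_smul_right]
  -- The posterior variance splits into the squared norm of the residual feature and the variance of
  -- the weighted noise.
  have hvar : ‖g‖ ^ 2 + ∑ i, v i * α i ^ 2 = postVar k z v p := by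
    have h1 : ⟪φ p, ∑ i, α i • φ (z i)⟫_ℝ = β ⬝ᵥ α := by
      simp only [inner_sum, real_inner_smul_right, hφ, dotProduct, hβ, mul_comm]
    have h2 : ∑ i, v i * α i ^ 2 = α ⬝ᵥ fun i => v i * α i :=
      Finset.sum_congr rfl fun i _ => by ring
    rw [hg, norm_sub_sq_real, h1, norm_sq_sum_feature hφ, hgram, mulVec_postWeights hk z hv,
      dotProduct_sub, ← real_inner_self_eq_norm_sq, hφ, postVar_eq, h2,
      dotProduct_comm _ fun i => k p (z i)]
    ring
  set c := A⁻¹ *ᵥ η with hc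
  have hAc : A *ᵥ c = η := by
    rw [hc, Matrix.mulVec_mulVec, Matrix.mul_nonsing_inv _ (isUnit_iff_ne_zero.2 hAdet),
      Matrix.one_mulVec]
  -- `u` represents the regression function fitted to pure noise. By `hQ` below, `noiseForm` is its
  -- squared norm plus its weighted squared values at the queries, matching the two summands of
  -- `hvar`.
  set u : H := ∑ i, c i • φ (z i) with hu
  have hui : ∀ i, ⟪u, φ (z i)⟫_ℝ = η i - v i * c i := fun i => by
    have h1 := congrFun (hgram c) i
    rw [hAc] at h1
    rw [Pi.sub_apply] at h1
    rw [← h1, hu, sum_inner]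
    simp only [real_inner_smul_left, hφ, Matrix.mulVec, dotProduct, gram, Matrix.of_apply]
    exact Finset.sum_congr rfl fun j _ => by rw [kernel_symm hk, mul_comm]
  have hup : ⟪u, φ p⟫_ℝ = postMean k z v η p := by
    rw [hu, sum_inner, postMean]
    simp only [real_inner_smul_left, hφ, dotProduct]
    exact Finset.sum_congr rfl fun j _ => by rw [kernel_symm hk, mul_comm]
  have hQ : ‖u‖ ^ 2 + ∑ i, ⟪u, φ (z i)⟫_ℝ ^ 2 / v i = noiseForm k z v η := by
    rw [hu, norm_sq_sum_feature hφ, hgram, hAc, ← hu, noiseForm, ← hA, ← hc]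
    simp only [hui, dotProduct, Pi.sub_apply, ← Finset.sum_add_distrib, ← Finset.sum_sub_distrib]
    refine Finset.sum_congr rfl fun i _ => ?_
    have := (hv i).ne'
    field_simp
    ring
  have hnoise : |postMean k z v η p| ≤ √(noiseForm k z v η) * √(postVar k z v p) := by
    have h1 : postMean k z v η p = ⟪u, g⟫_ℝ + ∑ i, α i * ⟪u, φ (z i)⟫_ℝ := by
      rw [hinner, hup]; ring
    rw [h1, ← hQ, ← hvar]
    refine add_mul_le_sqrt_mul_sqrt (Finset.sum_nonneg fun i _ => div_nonneg (sq_nonneg _) (hv i).le)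
      (Finset.sum_nonneg fun i _ => mul_nonneg (hv i).le (sq_nonneg _))
      (abs_real_inner_le_norm _ _) ?_
    have h2 := Finset.sum_mul_sq_le_sq_mul_sq Finset.univ
      (fun i => ⟪u, φ (z i)⟫_ℝ / √(v i)) (fun i => √(v i) * α i)
    have e1 : ∑ i, ⟪u, φ (z i)⟫_ℝ / √(v i) * (√(v i) * α i) = ∑ i, α i * ⟪u, φ (z i)⟫_ℝ :=
      Finset.sum_congr rfl fun i _ => by
        have := (Real.sqrt_pos.2 (hv i)).ne'
        field_simp
    have e2 : ∑ i, (⟪u, φ (z i)⟫_ℝ / √(v i)) ^ 2 = ∑ i, ⟪u, φ (z i)⟫_ℝ ^ 2 / v i :=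
      Finset.sum_congr rfl fun i _ => by rw [div_pow, Real.sq_sqrt (hv i).le]
    have e3 : ∑ i, (√(v i) * α i) ^ 2 = ∑ i, v i * α i ^ 2 :=
      Finset.sum_congr rfl fun i _ => by rw [mul_pow, Real.sq_sqrt (hv i).le]
    rwa [e1, e2, e3] at h2
  have hbias : |⟪h, g⟫_ℝ| ≤ ‖h‖ * √(postVar k z v p) := by
    refine (abs_real_inner_le_norm _ _).trans ?_
    gcongr
    refine Real.le_sqrt_of_sq_le ?_
    rw [← hvar]
    have : 0 ≤ ∑ i, v i * α i ^ 2 := Finset.sum_nonneg fun i _ => mul_nonneg (hv i).le (sq_nonneg _)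
    linarith
  have hsplit : ⟪h, φ p⟫_ℝ - postMean k z v (fun i => ⟪h, φ (z i)⟫_ℝ + η i) p =
      ⟪h, g⟫_ℝ - postMean k z v η p := by
    rw [postMean_eq_dotProduct hk z hv, postMean_eq_dotProduct hk z hv, hinner]
    simp only [dotProduct, add_mul, Finset.sum_add_distrib, ← hα, mul_comm (α _)]
    ring
  rw [hsplit, add_mul]
  exact (abs_sub _ _).trans (add_le_add hbias hnoise)

end Band

/-! ### Conditionally sub-Gaussian noise and self-normalised supermartingales -/

section SubGaussian

variable {S : Type*} {m m0 : MeasurableSpace S} {P : Measure S}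

/-- The hypothesis compares the measures with densities `g` and `h` after restriction to the
σ-algebra `m`, and `Y` is integrated only against these restrictions. -/
theorem lintegral_mul_le_of_setLIntegral_le (hm : m ≤ m0) {g h Y : S → ℝ≥0∞}
    (hg : Measurable g) (hh : Measurable h) (hY : Measurable[m] Y)
    (hgh : ∀ s, MeasurableSet[m] s → ∫⁻ ω in s, g ω ∂P ≤ ∫⁻ ω in s, h ω ∂P) :
    ∫⁻ ω, Y ω * g ω ∂P ≤ ∫⁻ ω, Y ω * h ω ∂P := by
  have hle : (P.withDensity g).trim hm ≤ (P.withDensity h).trim hm := by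
    refine Measure.le_iff.2 fun s hs => ?_
    rw [trim_measurableSet_eq hm hs, trim_measurableSet_eq hm hs, withDensity_apply _ (hm s hs),
      withDensity_apply _ (hm s hs)]
    exact hgh s hs
  have heq : ∀ g : S → ℝ≥0∞, Measurable g →
      ∫⁻ ω, Y ω * g ω ∂P = ∫⁻ ω, Y ω ∂((P.withDensity g).trim hm) := fun g hg => by
    rw [lintegral_trim hm hY, lintegral_withDensity_eq_lintegral_mul _ hg (hY.mono hm le_rfl)]
    simp only [Pi.mul_apply, mul_comm]
  rw [heq g hg, heq h hh]
  exact lintegral_mono' hle le_rfl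

/-- `η` has conditional moment generating function at most that of a centred Gaussian variable of
variance `v`, in integrated form. -/
def CondSubGaussian (P : Measure S) (m : MeasurableSpace S) (η v : S → ℝ) : Prop :=
  ∀ a : ℝ, ∀ s, MeasurableSet[m] s →
    ∫⁻ ω in s, ENNReal.ofReal (Real.exp (a * η ω)) ∂P ≤
      ∫⁻ ω in s, ENNReal.ofReal (Real.exp (a ^ 2 * v ω / 2)) ∂P

variable {η v : S → ℝ}

theorem CondSubGaussian.lintegral_const_le (h : CondSubGaussian P m η v) (hm : m ≤ m0)
    (hη : Measurable η) (hv : Measurable[m] v) {Y : S → ℝ≥0∞} (hY : Measurable[m] Y) (a : ℝ) :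
    ∫⁻ ω, Y ω * ENNReal.ofReal (Real.exp (a * η ω - a ^ 2 * v ω / 2)) ∂P ≤ ∫⁻ ω, Y ω ∂P := by
  have hv0 : Measurable v := hv.mono hm le_rfl
  have hY' : Measurable[m] fun ω => Y ω * ENNReal.ofReal (Real.exp (-(a ^ 2 * v ω / 2))) :=
    hY.mul (((hv.const_mul _).div_const _).neg.exp.ennreal_ofReal)
  have := lintegral_mul_le_of_setLIntegral_le (P := P) hm (by fun_prop) (by fun_prop) hY' (h a)
  calc ∫⁻ ω, Y ω * ENNReal.ofReal (Real.exp (a * η ω - a ^ 2 * v ω / 2)) ∂P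
      = ∫⁻ ω, Y ω * ENNReal.ofReal (Real.exp (-(a ^ 2 * v ω / 2))) *
          ENNReal.ofReal (Real.exp (a * η ω)) ∂P := by
        refine lintegral_congr fun ω => ?_
        rw [mul_assoc, ← ENNReal.ofReal_mul (Real.exp_nonneg _), ← Real.exp_add]
        ring_nf
    _ ≤ _ := this
    _ = ∫⁻ ω, Y ω ∂P := by
        refine lintegral_congr fun ω => ?_
        rw [mul_assoc, ← ENNReal.ofReal_mul (Real.exp_nonneg _), ← Real.exp_add]
        simp

theorem CondSubGaussian.lintegral_finite_range_le (h : CondSubGaussian P m η v) (hm : m ≤ m0)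
    (hη : Measurable η) (hv : Measurable[m] v) {Y : S → ℝ≥0∞} (hY : Measurable[m] Y)
    {A : S → ℝ} (hA : Measurable[m] A) (F : Finset ℝ) (hF : ∀ ω, A ω ∈ F) :
    ∫⁻ ω, Y ω * ENNReal.ofReal (Real.exp (A ω * η ω - A ω ^ 2 * v ω / 2)) ∂P ≤
      ∫⁻ ω, Y ω ∂P := by
  have hfib : ∀ a, MeasurableSet[m] (A ⁻¹' {a}) := fun a => hA (measurableSet_singleton a)
  have hsplit : ∀ (G : S → ℝ≥0∞), Measurable G →
      ∫⁻ ω, G ω ∂P = ∑ a ∈ F, ∫⁻ ω, (A ⁻¹' {a}).indicator G ω ∂P := by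
    intro G hG
    rw [← lintegral_finsetSum _ fun a _ => hG.indicator (hm _ (hfib a))]
    refine lintegral_congr fun ω => ?_
    rw [Finset.sum_eq_single (A ω)]
    · simp
    · intro b _ hb
      exact Set.indicator_of_notMem (fun hω => hb hω.symm) _
    · exact fun hω => (hω (hF ω)).elim
  have hv0 : Measurable v := hv.mono hm le_rfl
  have hY0 : Measurable Y := hY.mono hm le_rfl
  have hA0 : Measurable A := hA.mono hm le_rfl
  rw [hsplit _ (by fun_prop), hsplit Y hY0]
  refine Finset.sum_le_sum fun a _ => ?_
  refine le_trans (le_of_eq ?_) (h.lintegral_const_le hm hη hv (hY.indicator (hfib a)) a)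
  refine lintegral_congr fun ω => ?_
  by_cases hω : ω ∈ A ⁻¹' {a}
  · have : A ω = a := hω
    simp [this]
  · simp [Set.indicator_of_notMem hω]

/-- A random exponent known from the past is approximated by simple functions, for which the fibres
reduce to constant exponents; Fatou's lemma passes to the limit without integrability assumptions.
-/
theorem CondSubGaussian.lintegral_le (h : CondSubGaussian P m η v) (hm : m ≤ m0)
    (hη : Measurable η) (hv : Measurable[m] v) {Y : S → ℝ≥0∞} (hY : Measurable[m] Y)
    {A : S → ℝ} (hA : Measurable[m] A) :
    ∫⁻ ω, Y ω * ENNReal.ofReal (Real.exp (A ω * η ω - A ω ^ 2 * v ω / 2)) ∂P ≤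
      ∫⁻ ω, Y ω ∂P := by
  have hv0 : Measurable v := hv.mono hm le_rfl
  have hY0 : Measurable Y := hY.mono hm le_rfl
  have hAs : StronglyMeasurable[m] A := hA.stronglyMeasurable
  have hlim : ∀ ω, Filter.Tendsto (fun n => ENNReal.ofReal (Real.exp
      (hAs.approx n ω * η ω - hAs.approx n ω ^ 2 * v ω / 2))) Filter.atTop
      (nhds (ENNReal.ofReal (Real.exp (A ω * η ω - A ω ^ 2 * v ω / 2)))) := fun ω => by
    have h1 := hAs.tendsto_approx ω
    refine ENNReal.tendsto_ofReal ((Real.continuous_exp.tendsto _).comp ?_)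
    exact (h1.mul_const _).sub (((h1.pow 2).mul_const _).div_const _)
  have hmeas : ∀ n, Measurable fun ω => Y ω * ENNReal.ofReal (Real.exp
      (hAs.approx n ω * η ω - hAs.approx n ω ^ 2 * v ω / 2)) := fun n => by
    have : Measurable (hAs.approx n) := (@SimpleFunc.measurable _ _ m _ (hAs.approx n)).mono hm le_rfl
    fun_prop
  calc ∫⁻ ω, Y ω * ENNReal.ofReal (Real.exp (A ω * η ω - A ω ^ 2 * v ω / 2)) ∂P
      ≤ ∫⁻ ω, Filter.liminf (fun n => Y ω * ENNReal.ofReal (Real.exp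
          (hAs.approx n ω * η ω - hAs.approx n ω ^ 2 * v ω / 2))) Filter.atTop ∂P := by
        refine lintegral_mono fun ω => le_of_eq ?_
        refine (ENNReal.Tendsto.const_mul (hlim ω) (Or.inl ?_)).liminf_eq.symm
        exact (ENNReal.ofReal_pos.2 (Real.exp_pos _)).ne'
    _ ≤ Filter.liminf (fun n => ∫⁻ ω, Y ω * ENNReal.ofReal (Real.exp
          (hAs.approx n ω * η ω - hAs.approx n ω ^ 2 * v ω / 2)) ∂P) Filter.atTop :=
        lintegral_liminf_le hmeas
    _ ≤ Filter.liminf (fun _ : ℕ => ∫⁻ ω, Y ω ∂P) Filter.atTop :=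
        Filter.liminf_le_liminf (Filter.Eventually.of_forall fun n =>
          h.lintegral_finite_range_le hm hη hv hY
            (@SimpleFunc.measurable _ _ m _ (hAs.approx n)) _
            (@SimpleFunc.mem_range_self _ _ m (hAs.approx n)))
    _ = ∫⁻ ω, Y ω ∂P := Filter.liminf_const _

/-- The likelihood ratio, at `y`, of a Gaussian prediction with mean `μ` and variance `s` plus noise
of variance `v`, and of the noise alone. -/
def predRatio (μ s v y : ℝ) : ℝ :=
  (√(1 + s / v))⁻¹ * Real.exp ((y ^ 2 / v - (y - μ) ^ 2 / (s + v)) / 2)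

/-- Completing the square in `u`. The exponent `a = (μ + √s u) / v` is chosen so that its term is
the likelihood ratio of N(μ + √s u, v) against N(0, v). -/
theorem lintegral_gaussian_tilt {μ s v : ℝ} (hs : 0 ≤ s) (hv : 0 < v) (y : ℝ) :
    ∫⁻ u, ENNReal.ofReal ((√(2 * Real.pi))⁻¹ * Real.exp (-(1 / 2) * u ^ 2)) *
      ENNReal.ofReal (Real.exp ((μ + √s * u) / v * y - ((μ + √s * u) / v) ^ 2 * v / 2)) =
      ENNReal.ofReal (predRatio μ s v y) := by
  set b : ℝ := (1 + s / v) / 2 with hb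
  have hb0 : 0 < b := by positivity
  set c : ℝ := √s * (y - μ) / v / (2 * b) with hc
  set K : ℝ := (√(2 * Real.pi))⁻¹ * Real.exp ((y ^ 2 / v - (y - μ) ^ 2 / (s + v)) / 2) with hK
  have hform : ∀ u : ℝ, (√(2 * Real.pi))⁻¹ * Real.exp (-(1 / 2) * u ^ 2) *
      Real.exp ((μ + √s * u) / v * y - ((μ + √s * u) / v) ^ 2 * v / 2) =
      K * Real.exp (-b * (u - c) ^ 2) := by
    intro u
    rw [hK, mul_assoc, mul_assoc, ← Real.exp_add, ← Real.exp_add]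
    congr 2
    obtain ⟨q, hq0, rfl⟩ : ∃ q, 0 ≤ q ∧ s = q ^ 2 := ⟨√s, Real.sqrt_nonneg _, (Real.sq_sqrt hs).symm⟩
    rw [hc, hb, Real.sqrt_sq hq0]
    have h1 : q ^ 2 + v ≠ 0 := by positivity
    have h2 : v + q ^ 2 ≠ 0 := by positivity
    have h3 : 1 + q ^ 2 / v = (v + q ^ 2) / v := by field_simp
    rw [h3]
    field_simp
    ring
  have hint : Integrable fun u : ℝ => Real.exp (-b * (u - c) ^ 2) :=
    (integrable_exp_neg_mul_sq hb0).comp_sub_right c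
  have hval : ∫ u : ℝ, Real.exp (-b * (u - c) ^ 2) = √(Real.pi / b) := by
    rw [integral_sub_right_eq_self fun u : ℝ => Real.exp (-b * u ^ 2)]
    exact integral_gaussian b
  have hK0 : 0 ≤ K := by positivity
  calc _ = ∫⁻ u, ENNReal.ofReal (K * Real.exp (-b * (u - c) ^ 2)) := by
        refine lintegral_congr fun u => ?_
        rw [← ENNReal.ofReal_mul (by positivity), hform]
    _ = ENNReal.ofReal (K * √(Real.pi / b)) := by
        rw [← ofReal_integral_eq_lintegral_ofReal (hint.const_mul K)
          (Filter.Eventually.of_forall fun u => by positivity), integral_const_mul, hval]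
    _ = _ := by
        congr 1
        have h4 : Real.pi / b = 2 * Real.pi / (1 + s / v) := by rw [hb]; field_simp
        have h5 : √(2 * Real.pi) ≠ 0 := by positivity
        rw [hK, predRatio, h4, Real.sqrt_div (by positivity)]
        field_simp

/-- Method of mixtures: by Tonelli the average over the auxiliary Gaussian `u` is taken last, and
for each fixed `u` the exponent is known from the past. -/
theorem CondSubGaussian.lintegral_predRatio_le [SFinite P] (h : CondSubGaussian P m η v)
    (hm : m ≤ m0)
    (hη : Measurable η) (hv : Measurable[m] v) (hv0 : ∀ ω, 0 < v ω) {Y : S → ℝ≥0∞}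
    (hY : Measurable[m] Y) {μ s : S → ℝ} (hμ : Measurable[m] μ) (hs : Measurable[m] s)
    (hs0 : ∀ ω, 0 ≤ s ω) :
    ∫⁻ ω, Y ω * ENNReal.ofReal (predRatio (μ ω) (s ω) (v ω) (η ω)) ∂P ≤ ∫⁻ ω, Y ω ∂P := by
  set g : ℝ → ℝ≥0∞ := fun u =>
    ENNReal.ofReal ((√(2 * Real.pi))⁻¹ * Real.exp (-(1 / 2) * u ^ 2)) with hg
  set T : S → ℝ → ℝ≥0∞ := fun ω u => ENNReal.ofReal (Real.exp
    ((μ ω + √(s ω) * u) / v ω * η ω - ((μ ω + √(s ω) * u) / v ω) ^ 2 * v ω / 2)) with hT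
  have hgm : Measurable g := by fun_prop
  have hμ' : Measurable μ := hμ.mono hm le_rfl
  have hs' : Measurable s := hs.mono hm le_rfl
  have hv' : Measurable v := hv.mono hm le_rfl
  have hY' : Measurable Y := hY.mono hm le_rfl
  have hTm : Measurable (Function.uncurry T) := by
    simp only [hT, Function.uncurry_def]
    fun_prop
  -- With `μ = s = y = 0` and `v = 1` the tilt is trivial, so the same formula gives the total mass
  -- of the Gaussian weight.
  have hg1 : ∫⁻ u, g u = 1 := by
    have := lintegral_gaussian_tilt (μ := 0) (s := 0) le_rfl one_pos 0
    simpa [predRatio, hg] using this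
  calc ∫⁻ ω, Y ω * ENNReal.ofReal (predRatio (μ ω) (s ω) (v ω) (η ω)) ∂P
      = ∫⁻ ω, (∫⁻ u, g u * (Y ω * T ω u)) ∂P := by
        refine lintegral_congr fun ω => ?_
        rw [← lintegral_gaussian_tilt (hs0 ω) (hv0 ω), ← lintegral_const_mul]
        · exact lintegral_congr fun u => by simp only [hg, hT]; ring
        · fun_prop
    _ = ∫⁻ u, ∫⁻ ω, g u * (Y ω * T ω u) ∂P := by
        refine lintegral_lintegral_swap (Measurable.aemeasurable ?_)
        exact (hgm.comp measurable_snd).mul ((hY'.comp measurable_fst).mul hTm)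
    _ ≤ ∫⁻ u, g u * (∫⁻ ω, Y ω ∂P) := by
        refine lintegral_mono fun u => ?_
        simp only
        have hTu : Measurable fun ω => T ω u :=
          hTm.comp (measurable_id.prodMk measurable_const)
        rw [lintegral_const_mul (f := fun ω => Y ω * T ω u) _ (hY'.mul hTu)]
        refine mul_le_mul_right ?_ _
        refine h.lintegral_le hm hη hv hY (A := fun ω => (μ ω + √(s ω) * u) / v ω) ?_
        exact (hμ.add (hs.sqrt.mul_const u)).div hv
    _ = ∫⁻ ω, Y ω ∂P := by rw [lintegral_mul_const _ hgm, hg1, one_mul]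

/-- Ville's maximal inequality for nonnegative supermartingales, in terms of lower integrals. -/
theorem ville_inequality {ℱ : Filtration ℕ m0} {N : ℕ → S → ℝ≥0∞}
    (hN : ∀ n, Measurable[ℱ n] (N n))
    (hsuper : ∀ n s, MeasurableSet[ℱ n] s → ∫⁻ ω in s, N (n + 1) ω ∂P ≤ ∫⁻ ω in s, N n ω ∂P)
    (c : ℝ≥0∞) : c * P {ω | ∃ n, c ≤ N n ω} ≤ ∫⁻ ω, N 0 ω ∂P := by
  set A : ℕ → Set S := fun n => {ω | ∃ i ≤ n, c ≤ N i ω} with hA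
  have hAm : ∀ n, MeasurableSet[ℱ n] (A n) := fun n => by
    have : A n = ⋃ i ∈ Set.Iic n, {ω | c ≤ N i ω} := by ext; simp [hA]
    rw [this]
    refine MeasurableSet.biUnion (Set.to_countable _) fun i hi => ?_
    exact ℱ.mono hi _ (hN i measurableSet_Ici)
  have hmono : Monotone A := fun i j hij ω ⟨l, hl, h⟩ => ⟨l, hl.trans hij, h⟩
  have hmk : ∀ (s : Set S) n, s ⊆ {ω | c ≤ N n ω} → MeasurableSet s →
      c * P s ≤ ∫⁻ ω in s, N n ω ∂P := fun s n hs hsm => by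
    rw [← setLIntegral_const]
    exact setLIntegral_mono' hsm fun ω hω => hs hω
  -- The left side bounds from below the mean of the process stopped on first reaching `c`. In the
  -- induction the supermartingale property is used on `(A n)ᶜ`, and new crossings contribute at
  -- least `c` times their probability.
  have key : ∀ n, c * P (A n) + ∫⁻ ω in (A n)ᶜ, N n ω ∂P ≤ ∫⁻ ω, N 0 ω ∂P := by
    intro n
    induction n with
    | zero =>
      refine le_of_le_of_eq ?_ (lintegral_add_compl (N 0) (ℱ.le 0 _ (hAm 0)))
      refine add_le_add_left (hmk _ _ (fun ω hω => ?_) (ℱ.le 0 _ (hAm 0))) _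
      obtain ⟨i, hi, h⟩ := hω
      obtain rfl : i = 0 := by omega
      exact h
    | succ n ih =>
      refine le_trans ?_ ih
      have hm1 := ℱ.le n _ (hAm n)
      have hm2 := ℱ.le _ _ (hAm (n + 1))
      have h1 : P (A (n + 1)) = P (A n) + P (A (n + 1) \ A n) := by
        rw [← measure_union Set.disjoint_sdiff_right (hm2.diff hm1),
          Set.union_sdiff_cancel (hmono n.le_succ)]
      have h2 : ∫⁻ ω in (A n)ᶜ, N (n + 1) ω ∂P =
          ∫⁻ ω in A (n + 1) \ A n, N (n + 1) ω ∂P + ∫⁻ ω in (A (n + 1))ᶜ, N (n + 1) ω ∂P := by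
        rw [← lintegral_union hm2.compl]
        · congr 2
          ext ω
          have : ω ∈ A n → ω ∈ A (n + 1) := fun h => hmono n.le_succ h
          simp only [Set.mem_compl_iff, Set.mem_union, Set.mem_sdiff]
          tauto
        · exact Set.disjoint_left.2 fun ω h h' => h' h.1
      have h3 : c * P (A (n + 1) \ A n) ≤ ∫⁻ ω in A (n + 1) \ A n, N (n + 1) ω ∂P := by
        refine hmk _ _ (fun ω hω => ?_) (hm2.diff hm1)
        obtain ⟨⟨i, hi, h⟩, hn⟩ := hω
        rcases Nat.lt_or_ge n i with hlt | hge
        · obtain rfl : i = n + 1 := by omega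
          exact h
        · exact (hn ⟨i, hge, h⟩).elim
      calc c * P (A (n + 1)) + ∫⁻ ω in (A (n + 1))ᶜ, N (n + 1) ω ∂P
          ≤ c * P (A n) + (∫⁻ ω in A (n + 1) \ A n, N (n + 1) ω ∂P +
            ∫⁻ ω in (A (n + 1))ᶜ, N (n + 1) ω ∂P) := by
            rw [h1, mul_add, add_assoc]
            gcongr
        _ ≤ _ := by
            rw [← h2]
            exact add_le_add_right (hsuper n _ (hAm n).compl) _
  have hU : {ω | ∃ n, c ≤ N n ω} = ⋃ n, A n := by
    ext ω
    simp only [hA, Set.mem_ofPred_eq, Set.mem_iUnion]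
    exact ⟨fun ⟨n, h⟩ => ⟨n, n, le_rfl, h⟩, fun ⟨_, i, _, h⟩ => ⟨i, h⟩⟩
  rw [hU, hmono.measure_iUnion, ENNReal.mul_iSup]
  exact iSup_le fun n => le_self_add.trans (key n)

end SubGaussian

/-! ### Measurability of the regression formulas -/

section Measurability

variable {T : Type*} {mT : MeasurableSpace T} {n : ℕ}

theorem measurable_det {A : T → Matrix (Fin n) (Fin n) ℝ}
    (hA : ∀ i j, Measurable fun ω => A ω i j) : Measurable fun ω => (A ω).det := by
  simp only [Matrix.det_apply]
  exact Finset.measurable_fun_sum _ fun σ _ =>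
    (Finset.measurable_fun_prod _ fun i _ => hA _ _).const_smul _

theorem measurable_matrix_inv {A : T → Matrix (Fin n) (Fin n) ℝ}
    (hA : ∀ i j, Measurable fun ω => A ω i j) (i j : Fin n) :
    Measurable fun ω => (A ω)⁻¹ i j := by
  simp only [Matrix.inv_def, Matrix.smul_apply, Ring.inverse_eq_inv', Matrix.adjugate_apply,
    smul_eq_mul]
  refine (measurable_det hA).inv.mul (measurable_det fun a b => ?_)
  simp only [Matrix.updateRow_apply]
  split_ifs
  · exact measurable_const
  · exact hA a b

theorem measurable_dotProduct_inv_mulVec {A : T → Matrix (Fin n) (Fin n) ℝ}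
    (hA : ∀ i j, Measurable fun ω => A ω i j) {a b : T → Fin n → ℝ}
    (ha : ∀ i, Measurable fun ω => a ω i) (hb : ∀ i, Measurable fun ω => b ω i) :
    Measurable fun ω => a ω ⬝ᵥ ((A ω)⁻¹ *ᵥ b ω) := by
  simp only [dotProduct, Matrix.mulVec]
  exact Finset.measurable_fun_sum _ fun i _ => (ha i).mul <|
    Finset.measurable_fun_sum _ fun j _ => (measurable_matrix_inv hA i j).mul (hb j)

variable {Z : Type*} [MeasurableSpace Z] {k : Z → Z → ℝ} {z : T → Fin n → Z}
  {v y : T → Fin n → ℝ} {p : T → Z}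

theorem measurable_kernel_apply (hk : Measurable (Function.uncurry k)) {p q : T → Z}
    (hp : Measurable p) (hq : Measurable q) : Measurable fun ω => k (p ω) (q ω) :=
  hk.comp (hp.prodMk hq)

theorem measurable_gram_add_diagonal (hk : Measurable (Function.uncurry k))
    (hz : ∀ i, Measurable fun ω => z ω i) (hv : ∀ i, Measurable fun ω => v ω i) (i j : Fin n) :
    Measurable fun ω => (gram k (z ω) + Matrix.diagonal (v ω)) i j := by
  simp only [Matrix.add_apply, gram, Matrix.of_apply, Matrix.diagonal_apply]
  refine (measurable_kernel_apply hk (hz i) (hz j)).add ?_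
  split_ifs
  · exact hv i
  · exact measurable_const

theorem measurable_detRatio (hk : Measurable (Function.uncurry k))
    (hz : ∀ i, Measurable fun ω => z ω i) (hv : ∀ i, Measurable fun ω => v ω i) :
    Measurable fun ω => detRatio k (z ω) (v ω) :=
  (measurable_det (measurable_gram_add_diagonal hk hz hv)).div
    (Finset.measurable_fun_prod _ fun i _ => hv i)

theorem measurable_noiseForm (hk : Measurable (Function.uncurry k))
    (hz : ∀ i, Measurable fun ω => z ω i) (hv : ∀ i, Measurable fun ω => v ω i)
    (hy : ∀ i, Measurable fun ω => y ω i) :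
    Measurable fun ω => noiseForm k (z ω) (v ω) (y ω) :=
  (Finset.measurable_fun_sum _ fun i _ => ((hy i).pow_const 2).div (hv i)).sub
    (measurable_dotProduct_inv_mulVec (measurable_gram_add_diagonal hk hz hv) hy hy)

theorem measurable_postVar (hk : Measurable (Function.uncurry k))
    (hz : ∀ i, Measurable fun ω => z ω i) (hv : ∀ i, Measurable fun ω => v ω i)
    (hp : Measurable p) : Measurable fun ω => postVar k (z ω) (v ω) (p ω) :=
  (measurable_kernel_apply hk hp hp).sub <|
    measurable_dotProduct_inv_mulVec (measurable_gram_add_diagonal hk hz hv)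
      (fun i => measurable_kernel_apply hk hp (hz i)) fun i => measurable_kernel_apply hk hp (hz i)

theorem measurable_postMean (hk : Measurable (Function.uncurry k))
    (hz : ∀ i, Measurable fun ω => z ω i) (hv : ∀ i, Measurable fun ω => v ω i)
    (hy : ∀ i, Measurable fun ω => y ω i) (hp : Measurable p) :
    Measurable fun ω => postMean k (z ω) (v ω) (y ω) (p ω) :=
  measurable_dotProduct_inv_mulVec (measurable_gram_add_diagonal hk hz hv)
    (fun i => measurable_kernel_apply hk hp (hz i)) hy

end Measurability

/-! ### The self-normalised supermartingale -/

section SelfNormalised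

variable {Z : Type*} {k : Z → Z → ℝ}

/-- The mixture likelihood ratio of the first `n` noise variables. -/
def mixtureRatio (k : Z → Z → ℝ) (z : ℕ → Z) (v η : ℕ → ℝ) (n : ℕ) : ℝ :=
  (√(detRatio k (fun i : Fin n => z i) fun i => v i))⁻¹ *
    Real.exp (noiseForm k (fun i : Fin n => z i) (fun i => v i) (fun i => η i) / 2)

theorem mixtureRatio_zero (z : ℕ → Z) (v η : ℕ → ℝ) : mixtureRatio k z v η 0 = 1 := by
  simp [mixtureRatio, detRatio, noiseForm]

theorem mixtureRatio_nonneg (z : ℕ → Z) (v η : ℕ → ℝ) (n : ℕ) : 0 ≤ mixtureRatio k z v η n := by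
  unfold mixtureRatio; positivity

theorem mixtureRatio_succ (hk : (Matrix.of k).PosSemidef) (z : ℕ → Z) {v : ℕ → ℝ}
    (hv : ∀ i, 0 < v i) (η : ℕ → ℝ) (n : ℕ) :
    mixtureRatio k z v η (n + 1) = mixtureRatio k z v η n *
      predRatio (postMean k (fun i : Fin n => z i) (fun i => v i) (fun i => η i) (z n))
        (postVar k (fun i : Fin n => z i) (fun i => v i) (z n)) (v n) (η n) := by
  have h1 := detRatio_succ hk (fun i : Fin (n + 1) => z i) (v := fun i => v i) fun i => hv i
  have h2 := noiseForm_succ hk (fun i : Fin (n + 1) => z i) (v := fun i => v i) (fun i => hv i)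
    (fun i => η i)
  simp only [Function.comp_def, Fin.val_castSucc, Fin.val_last] at h1 h2
  rw [mixtureRatio, h1, h2, Real.sqrt_mul (detRatio_pos hk _ fun i => hv i).le, mixtureRatio,
    predRatio, add_div, Real.exp_add, mul_inv]
  ring

variable {S : Type*} {m0 : MeasurableSpace S} {P : Measure S} [MeasurableSpace Z]
  {ℱ : Filtration ℕ m0} {z : ℕ → S → Z} {v η : ℕ → S → ℝ}

theorem measurable_mixtureRatio (hk : Measurable (Function.uncurry k))
    (hz : ∀ t, Measurable[ℱ t] (z t)) (hv : ∀ t, Measurable[ℱ t] (v t))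
    (hη : ∀ t, Measurable[ℱ (t + 1)] (η t)) (n : ℕ) :
    Measurable[ℱ n] fun ω => mixtureRatio k (fun t => z t ω) (fun t => v t ω) (fun t => η t ω) n := by
  have hz' : ∀ i : Fin n, Measurable[ℱ n] (z i) := fun i =>
    (hz i).mono (ℱ.mono i.2.le) le_rfl
  have hv' : ∀ i : Fin n, Measurable[ℱ n] (v i) := fun i =>
    (hv i).mono (ℱ.mono i.2.le) le_rfl
  have hη' : ∀ i : Fin n, Measurable[ℱ n] (η i) := fun i =>
    (hη i).mono (ℱ.mono i.2) le_rfl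
  exact (measurable_detRatio hk hz' hv').sqrt.inv.mul
    ((measurable_noiseForm hk hz' hv' hη').div_const 2).exp

theorem measurableSet_mixtureRatio_ge (hk : Measurable (Function.uncurry k))
    (hz : ∀ t, Measurable[ℱ t] (z t)) (hv : ∀ t, Measurable[ℱ t] (v t))
    (hη : ∀ t, Measurable[ℱ (t + 1)] (η t)) (c : ℝ) :
    MeasurableSet {ω | ∃ n, c ≤
      mixtureRatio k (fun t => z t ω) (fun t => v t ω) (fun t => η t ω) n} := by
  rw [Set.ofPred_exists]
  exact MeasurableSet.iUnion fun n =>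
    ℱ.le n _ (measurable_mixtureRatio hk hz hv hη n measurableSet_Ici)

/-- Time-uniform bound for the self-normalised noise. -/
theorem measure_mixtureRatio_ge_le [IsProbabilityMeasure P]
    (hpd : (Matrix.of k).PosSemidef) (hk : Measurable (Function.uncurry k))
    (hz : ∀ t, Measurable[ℱ t] (z t)) (hv : ∀ t, Measurable[ℱ t] (v t))
    (hv0 : ∀ t ω, 0 < v t ω) (hη : ∀ t, Measurable[ℱ (t + 1)] (η t))
    (hsub : ∀ t, CondSubGaussian P (ℱ t) (η t) (v t)) {c : ℝ} (hc : 0 < c) :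
    P {ω | ∃ n, c ≤ mixtureRatio k (fun t => z t ω) (fun t => v t ω) (fun t => η t ω) n} ≤
      ENNReal.ofReal c⁻¹ := by
  set N : ℕ → S → ℝ≥0∞ := fun n ω =>
    ENNReal.ofReal (mixtureRatio k (fun t => z t ω) (fun t => v t ω) (fun t => η t ω) n) with hN
  have hNm : ∀ n, Measurable[ℱ n] (N n) := fun n =>
    (measurable_mixtureRatio hk hz hv hη n).ennreal_ofReal
  have hsuper : ∀ n s, MeasurableSet[ℱ n] s →
      ∫⁻ ω in s, N (n + 1) ω ∂P ≤ ∫⁻ ω in s, N n ω ∂P := by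
    intro n s hs
    have hz' : ∀ i : Fin n, Measurable[ℱ n] (z i) := fun i => (hz i).mono (ℱ.mono i.2.le) le_rfl
    have hv' : ∀ i : Fin n, Measurable[ℱ n] (v i) := fun i => (hv i).mono (ℱ.mono i.2.le) le_rfl
    have hη' : ∀ i : Fin n, Measurable[ℱ n] (η i) := fun i => (hη i).mono (ℱ.mono i.2) le_rfl
    -- The current ratio restricted to `s` is known at time `n` and acts as the multiplier `Y` of
    -- the one-step bound.
    rw [← lintegral_indicator (ℱ.le n _ hs), ← lintegral_indicator (ℱ.le n _ hs)]
    refine le_trans (le_of_eq (lintegral_congr fun ω => ?_))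
      ((hsub n).lintegral_predRatio_le (ℱ.le n) ((hη n).mono (ℱ.le _) le_rfl) (hv n) (hv0 n)
        ((hNm n).indicator hs) (measurable_postMean hk hz' hv' hη' (hz n))
        (measurable_postVar hk hz' hv' (hz n))
        fun ω => postVar_nonneg hpd _ (fun i => hv0 i ω) _)
    by_cases hω : ω ∈ s
    · rw [Set.indicator_of_mem hω, Set.indicator_of_mem hω]
      simp only [hN]
      rw [← ENNReal.ofReal_mul (mixtureRatio_nonneg _ _ _ _),
        mixtureRatio_succ hpd _ fun t => hv0 t ω]
    · simp [Set.indicator_of_notMem hω]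
  have hville := ville_inequality hNm hsuper (ENNReal.ofReal c)
  have hset : {ω | ∃ n, ENNReal.ofReal c ≤ N n ω} =
      {ω | ∃ n, c ≤ mixtureRatio k (fun t => z t ω) (fun t => v t ω) (fun t => η t ω) n} := by
    ext ω
    simp only [hN, Set.mem_ofPred_eq, ENNReal.ofReal_le_ofReal_iff (mixtureRatio_nonneg _ _ _ _)]
  rw [hset] at hville
  simp only [hN, mixtureRatio_zero, ENNReal.ofReal_one, lintegral_one, measure_univ] at hville
  rw [ENNReal.ofReal_inv_of_pos hc, ENNReal.le_inv_iff_mul_le, mul_comm]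
  exact hville

end SelfNormalised

/-! ### Time-uniform confidence bands for a run -/

section Noise

variable {S : Type*} {m m0 : MeasurableSpace S} {P : Measure S} [IsProbabilityMeasure P]

theorem CondSubGaussian.of_condExp_le (hm : m ≤ m0) {η v : S → ℝ}
    (hint : ∀ a : ℝ, Integrable (fun ω => Real.exp (a * η ω)) P)
    (hle : ∀ a : ℝ, P[fun ω => Real.exp (a * η ω) | m] ≤ᵐ[P] fun ω => Real.exp (a ^ 2 * v ω / 2)) :
    CondSubGaussian P m η v := by
  intro a s hs
  rw [← ofReal_integral_eq_lintegral_ofReal (hint a).integrableOn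
    (Filter.Eventually.of_forall fun _ => (Real.exp_pos _).le),
    ← setIntegral_condExp hm (hint a) hs, ofReal_integral_eq_lintegral_ofReal
      integrable_condExp.integrableOn (ae_restrict_of_ae
        (condExp_nonneg (Filter.Eventually.of_forall fun _ => (Real.exp_pos _).le)))]
  refine lintegral_mono_ae (ae_restrict_of_ae ?_)
  filter_upwards [hle a] with ω hω using ENNReal.ofReal_le_ofReal hω

end Noise

section Run

variable {S X W : Type*} [MeasurableSpace S] [MeasurableSpace X] [MeasurableSpace W] {M : ℕ}
  {P : Measure S} [IsProbabilityMeasure P] {R : Run S X W M}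

theorem Run.SubGaussianNoise.condSubGaussian {τ : Fin M → X × W → ℝ}
    (h : R.SubGaussianNoise P τ) (m : Fin M) (t : ℕ) :
    CondSubGaussian P (R.hist t) (R.noise m t) fun ω => τ m (R.x t ω, R.w t ω) ^ 2 :=
  .of_condExp_le (R.hist.le t) (fun a => ((h m t).2 a).1) fun a => ((h m t).2 a).2

/-- Independence makes the conditional moment generating function constant, equal to the Gaussian
one. -/
theorem Run.GaussianNoise.condSubGaussian {s : Fin M → ℝ}
    (h : R.GaussianNoise P s) (m : Fin M) (t : ℕ) :
    CondSubGaussian P (R.hist t) (R.noise m t) fun _ => s m ^ 2 := by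
  have hmeas : Measurable (R.noise m t) := (R.noise_meas m t).mono (R.hist.le _) le_rfl
  have hmgf : ∀ a : ℝ, ∫ ω, Real.exp (a * R.noise m t ω) ∂P = Real.exp (a ^ 2 * s m ^ 2 / 2) := by
    intro a
    have := mgf_gaussianReal (h m t).1 a
    rw [mgf] at this
    rw [this, Real.coe_toNNReal _ (sq_nonneg _)]
    ring_nf
  refine .of_condExp_le (R.hist.le t) (fun a => ?_) fun a => ?_
  -- The integral of a non-integrable function is 0 by convention, while this one is positive.
  · exact Integrable.of_integral_ne_zero ((hmgf a).trans_ne (Real.exp_pos _).ne')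
  · have hexp : StronglyMeasurable[MeasurableSpace.comap (R.noise m t) inferInstance]
        fun ω => Real.exp (a * R.noise m t ω) :=
      (Real.measurable_exp.comp ((measurable_const_mul a).comp
        (comap_measurable _))).stronglyMeasurable
    filter_upwards [condExp_indep_eq hmeas.comap_le (R.hist.le t) hexp (h m t).2] with ω hω
    rw [hω, hmgf]

end Run

/-! ### Rescaled kernels, determinant ratios and the confidence parameters -/

section Scaling

variable {Z : Type*} {k : Z → Z → ℝ}

theorem posSemidef_scaled (hk : (Matrix.of k).PosSemidef) {lam : ℝ} (hlam : 0 < lam) :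
    (Matrix.of fun p q => 1 / lam * k p q).PosSemidef :=
  hk.smul (by positivity : 0 ≤ 1 / lam)

theorem gram_scaled {lam : ℝ} {n : ℕ} (z : Fin n → Z) :
    gram (fun p q => 1 / lam * k p q) z = (1 / lam) • gram k z := rfl

theorem betaSubG_eq (hk : (Matrix.of k).PosSemidef) (B : ℝ) {lam : ℝ} (hlam : 0 < lam) (δ : ℝ)
    (M : ℕ) {n : ℕ} (z : Fin n → Z) {v : Fin n → ℝ} (hv : ∀ i, 0 < v i) :
    betaSubG k B lam δ M z v =
      B * √lam + √(2 * Real.log (√(detRatio (fun p q => 1 / lam * k p q) z v) * (M / δ))) := by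
  have h1 : lam • Matrix.diagonal v + gram k z =
      lam • (gram (fun p q => 1 / lam * k p q) z + Matrix.diagonal v) := by
    rw [gram_scaled, smul_add, smul_smul, mul_one_div_cancel hlam.ne', one_smul, add_comm]
  have hlamn : 0 < √(lam ^ n) := by positivity
  have h2 : 0 < √(∏ i, v i) := Real.sqrt_pos.2 (Finset.prod_pos fun i _ => hv i)
  have hratio : √(lam • Matrix.diagonal v + gram k z).det /
      ((M : ℝ)⁻¹ * δ * √(lam • Matrix.diagonal v).det) =
      √(detRatio (fun p q => 1 / lam * k p q) z v) * (M / δ) := by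
    rw [h1, Matrix.det_smul, Matrix.det_smul, Matrix.det_diagonal, Fintype.card_fin,
      Real.sqrt_mul (pow_nonneg hlam.le n), Real.sqrt_mul (pow_nonneg hlam.le n), detRatio,
      Real.sqrt_div (posDef_gram_add_diagonal (posSemidef_scaled hk hlam) z hv).det_pos.le]
    -- For `δ = 0` or `M = 0`, division by zero makes both sides 0.
    rcases eq_or_ne δ 0 with rfl | hδ
    · simp
    rcases eq_or_ne (M : ℝ) 0 with hM | hM
    · simp [hM]
    field_simp
  rw [betaSubG, hratio]

/-- Each new query multiplies the ratio by one plus a nonnegative signal-to-noise quotient. -/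
theorem detRatio_mono (hk : (Matrix.of k).PosSemidef) (z : ℕ → Z) {v : ℕ → ℝ}
    (hv : ∀ i, 0 < v i) : Monotone fun n => detRatio k (fun i : Fin n => z i) fun i => v i := by
  refine monotone_nat_of_le_succ fun n => ?_
  have h := detRatio_succ hk (fun i : Fin (n + 1) => z i) (v := fun i => v i) fun i => hv i
  simp only [Function.comp_def, Fin.val_castSucc, Fin.val_last] at h
  rw [h]
  refine le_mul_of_one_le_right (detRatio_pos hk _ fun i => hv i).le ?_
  have := div_nonneg (postVar_nonneg hk (fun i : Fin n => z i) (v := fun i => v i)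
    (fun i => hv i) (z n)) (hv n).le
  linarith

theorem detRatio_const_eq {s : ℝ} (hs : 0 < s) {n : ℕ} (z : Fin n → Z) :
    detRatio k z (fun _ => s ^ 2) =
      ((1 : Matrix (Fin n) (Fin n) ℝ) + (s ^ 2)⁻¹ • gram k z).det := by
  have h : gram k z + Matrix.diagonal (fun _ => s ^ 2) =
      s ^ 2 • ((1 : Matrix (Fin n) (Fin n) ℝ) + (s ^ 2)⁻¹ • gram k z) := by
    rw [smul_add, smul_smul, mul_inv_cancel₀ (by positivity), one_smul, add_comm,
      Matrix.smul_one_eq_diagonal]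
  rw [detRatio, h, Matrix.det_smul, Finset.prod_const, Fintype.card_fin, Finset.card_univ,
    Fintype.card_fin, mul_div_cancel_left₀ _ (by positivity)]

/-- A crude bound uniform in the points; it makes the supremum in `infoGain` a genuine one, since an
unbounded real supremum would default to 0. -/
theorem detRatio_const_le (hk : (Matrix.of k).PosSemidef) (hk1 : ∀ p, k p p ≤ 1) {s : ℝ}
    (hs : 0 < s) {n : ℕ} (z : Fin n → Z) :
    detRatio k z (fun _ => s ^ 2) ≤ (1 + (s ^ 2)⁻¹) ^ n := by
  have hs2 : 0 < s ^ 2 := by positivity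
  induction n with
  | zero => simp [detRatio]
  | succ n ih =>
    rw [detRatio_succ hk z fun _ => hs2, pow_succ]
    have h0 := postVar_nonneg hk (z ∘ Fin.castSucc) (v := fun _ => s ^ 2) (fun _ => hs2)
      (z (Fin.last n))
    have h1 := (postVar_le hk (z ∘ Fin.castSucc) (v := fun _ => s ^ 2) (fun _ => hs2)
      (z (Fin.last n))).trans (hk1 _)
    refine mul_le_mul (ih _) ?_ (add_nonneg zero_le_one (div_nonneg h0 hs2.le))
      (pow_nonneg (by positivity) n)
    rw [inv_eq_one_div]
    gcongr
    exact h1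

theorem log_detRatio_le_infoGain (hk : (Matrix.of k).PosSemidef) (hk1 : ∀ p, k p p ≤ 1) {s : ℝ}
    (hs : 0 < s) {n : ℕ} (z : Fin n → Z) :
    Real.log (√(detRatio k z fun _ => s ^ 2)) ≤ infoGain k s n := by
  have hs2 : 0 < s ^ 2 := by positivity
  rw [Real.log_sqrt (detRatio_pos hk z fun _ => hs2).le, infoGain, div_eq_inv_mul]
  have hbdd : BddAbove (Set.range fun z : Fin n → Z =>
      Real.log ((1 : Matrix (Fin n) (Fin n) ℝ) + (s ^ 2)⁻¹ • gram k z).det) := by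
    refine ⟨Real.log ((1 + (s ^ 2)⁻¹) ^ n), ?_⟩
    rintro _ ⟨z', rfl⟩
    simp only
    rw [← detRatio_const_eq hs]
    exact Real.log_le_log (detRatio_pos hk z' fun _ => hs2) (detRatio_const_le hk hk1 hs z')
  rw [detRatio_const_eq hs]
  exact mul_le_mul_of_nonneg_left (le_ciSup hbdd z) (by norm_num)

open scoped InnerProductSpace in
/-- On the event that the mixture ratio stays below `c`, the function lies in its band. -/
theorem abs_sub_postMean_le_of_mixtureRatio_lt {Z : Type} {k : Z → Z → ℝ} {B : ℝ} {f : Z → ℝ}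
    (hf : InRKHSBall k B f) (hk : (Matrix.of k).PosSemidef) {lam : ℝ} (hlam : 0 < lam)
    (z : ℕ → Z) {v : ℕ → ℝ} (hv : ∀ i, 0 < v i) (η : ℕ → ℝ) {n : ℕ} {c : ℝ}
    (hc : mixtureRatio (fun p q => 1 / lam * k p q) z v η n < c) (p : Z) :
    |f p - postMean (fun p q => 1 / lam * k p q) (fun i : Fin n => z i) (fun i => v i)
        (fun i => f (z i) + η i) p| ≤
      (B * √lam + √(2 * Real.log (√(detRatio (fun p q => 1 / lam * k p q) (fun i : Fin n => z i)
        fun i => v i) * c))) *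
        √(postVar (fun p q => 1 / lam * k p q) (fun i : Fin n => z i) (fun i => v i) p) := by
  obtain ⟨H, _, _, φ, h, hφ, hfh, hB⟩ := hf.exists_feature
  have hsq : √lam * √lam = lam := Real.mul_self_sqrt hlam.le
  have hsl : √lam ≠ 0 := (Real.sqrt_pos.2 hlam).ne'
  have hk' := posSemidef_scaled hk hlam
  -- Dividing the features by `√lam` realises the kernel `k / lam`; the representing vector is
  -- multiplied by `√lam` to keep `f`, which is the origin of `B * √lam`.
  have hφ' : ∀ p q, ⟪(√lam)⁻¹ • φ p, (√lam)⁻¹ • φ q⟫_ℝ = 1 / lam * k p q := fun p q => by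
    rw [real_inner_smul_left, real_inner_smul_right, hφ, ← mul_assoc, ← mul_inv, hsq, one_div]
  have hfh' : ∀ p, ⟪√lam • h, (√lam)⁻¹ • φ p⟫_ℝ = f p := fun p => by
    rw [real_inner_smul_left, real_inner_smul_right, mul_inv_cancel_left₀ hsl, hfh]
  have key := abs_sub_postMean_le (k := fun p q => 1 / lam * k p q) hφ' hk'
    (fun i : Fin n => z i) (v := fun i => v i) (fun i => hv i) (√lam • h) (fun i => η i) p
  simp only [hfh'] at key
  refine key.trans ?_
  gcongr
  · rw [norm_smul, Real.norm_of_nonneg (Real.sqrt_nonneg _), mul_comm]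
    gcongr
  · rw [mixtureRatio] at hc
    have hD : 0 < √(detRatio (fun p q => 1 / lam * k p q) (fun i : Fin n => z i) fun i => v i) :=
      Real.sqrt_pos.2 (detRatio_pos hk' _ fun i => hv i)
    rw [inv_mul_lt_iff₀ hD] at hc
    have := (Real.lt_log_iff_exp_lt ((Real.exp_pos _).trans hc)).2 hc
    linarith

end Scaling

/-! ### Union bound over the functions and passage to the inference discrepancy -/

section Confidence

variable {S : Type*} {X W : Type} [MeasurableSpace S] [MeasurableSpace X] [MeasurableSpace W]
  {M : ℕ} {P : Measure S} [IsProbabilityMeasure P]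

/-- Confidence bands that hold for all functions, all times and all points simultaneously. -/
theorem exists_uniform_band {k : Fin M → X × W → X × W → ℝ} {f : Fin M → X × W → ℝ}
    {B : Fin M → ℝ} (hreg : ∀ m, Regular (k m) (B m) (f m)) (R : Run S X W M) {δ : ℝ} (hδ : 0 < δ)
    {lam : Fin M → ℝ} (hlam : ∀ m, 0 < lam m) {τ : Fin M → X × W → ℝ}
    (hτ : ∀ m, Measurable (τ m)) (hτ0 : ∀ m z, 0 < τ m z)
    (hsub : ∀ m t, CondSubGaussian P (R.hist t) (R.noise m t)
      fun ω => τ m (R.x t ω, R.w t ω) ^ 2) :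
    ∃ A, MeasurableSet A ∧ ENNReal.ofReal (1 - δ) ≤ P A ∧ ∀ ω ∈ A, ∀ m t p,
      |f m p - hMean k f lam τ R ω m t p| ≤
        (B m * √(lam m) + √(2 * Real.log (√(detRatio (fun p q => 1 / lam m * k m p q)
          (R.pts t ω) (vars τ R ω m t)) * (M / δ)))) * hSd k lam τ R ω m t p := by
  set bad : Fin M → Set S := fun m => {ω | ∃ n, (M / δ : ℝ) ≤
    mixtureRatio (fun p q => 1 / lam m * k m p q) (fun t => (R.x t ω, R.w t ω))
      (fun t => τ m (R.x t ω, R.w t ω) ^ 2) (fun t => R.noise m t ω) n} with hbad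
  have hz : ∀ t, Measurable[R.hist t] fun ω => (R.x t ω, R.w t ω) := fun t =>
    (R.x_meas t).prodMk (R.w_meas t)
  have hv : ∀ m t, Measurable[R.hist t] fun ω => τ m (R.x t ω, R.w t ω) ^ 2 := fun m t =>
    ((hτ m).comp (hz t)).pow_const 2
  have hkm : ∀ m, Measurable (Function.uncurry fun p q => 1 / lam m * k m p q) := fun m =>
    (hreg m).measurable.const_mul _
  have hbm : ∀ m, MeasurableSet (bad m) := fun m =>
    measurableSet_mixtureRatio_ge (hkm m) hz (hv m) (R.noise_meas m) _
  have hbP : ∀ m, P (bad m) ≤ ENNReal.ofReal (δ / M) := fun m => by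
    have hM : (0 : ℝ) < M := Nat.cast_pos.2 m.pos
    have := measure_mixtureRatio_ge_le (P := P) (posSemidef_scaled (hreg m).posDef (hlam m)) (hkm m)
      hz (hv m) (fun t ω => pow_pos (hτ0 m _) 2) (R.noise_meas m) (hsub m) (c := M / δ)
      (by positivity)
    rwa [inv_div] at this
  have hU : P (⋃ m, bad m) ≤ ENNReal.ofReal δ := by
    refine (measure_iUnion_fintype_le P bad).trans ((Finset.sum_le_sum fun m _ => hbP m).trans ?_)
    rw [Finset.sum_const, Finset.card_univ, Fintype.card_fin, nsmul_eq_mul,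
      ← ENNReal.ofReal_natCast, ← ENNReal.ofReal_mul (Nat.cast_nonneg M)]
    refine ENNReal.ofReal_le_ofReal ?_
    rcases eq_or_ne (M : ℝ) 0 with hM | hM
    · simp [hM, hδ.le]
    · rw [mul_div_cancel₀ _ hM]
  refine ⟨(⋃ m, bad m)ᶜ, (MeasurableSet.iUnion hbm).compl, ?_, fun ω hω m t p => ?_⟩
  · rw [prob_compl_eq_one_sub (MeasurableSet.iUnion hbm), ENNReal.ofReal_sub _ hδ.le,
      ENNReal.ofReal_one]
    exact tsub_le_tsub_left hU 1
  · have hlt : mixtureRatio (fun p q => 1 / lam m * k m p q) (fun t => (R.x t ω, R.w t ω))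
        (fun t => τ m (R.x t ω, R.w t ω) ^ 2) (fun t => R.noise m t ω) t < M / δ := by
      by_contra! hge
      exact hω (Set.mem_iUnion.2 ⟨m, t, hge⟩)
    exact abs_sub_postMean_le_of_mixtureRatio_lt (hreg m).mem (hreg m).posDef (hlam m)
      (fun t => (R.x t ω, R.w t ω)) (fun i => pow_pos (hτ0 m _) 2) _ hlt p

theorem mem_band_of_abs_sub_le {W : Type*} {ρ : RiskMeasure W} {g μ σ : W → ℝ} {b b' : ℝ}
    (hg : g ∈ ρ.dom) (hσ : ∀ w, 0 ≤ σ w) (hb : b' ≤ b) (h : ∀ w, |g w - μ w| ≤ b' * σ w) :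
    g ∈ band ρ μ σ b := by
  refine ⟨hg, fun w => ?_⟩
  have h1 := abs_le.1 ((h w).trans (mul_le_mul_of_nonneg_right hb (hσ w)))
  exact ⟨by linarith [h1.1], by linarith [h1.2]⟩

/-- Transfer of uniform confidence bands to the inference discrepancy. -/
theorem guarantee_of_band {S X W ι : Type*} [MeasurableSpace S] [MeasurableSpace X]
    [MeasurableSpace W] [Fintype ι] {M : ℕ} {P : Measure S} {R : Run S X W M}
    {E : Estimates S X ι} {ρ : X → ι → RiskMeasure W} {G : S → ℕ → X → ι → Set (W → ℝ)}
    {f : ι → X × W → ℝ} {δ ε εlcb εucb εPF εX : ℝ} (hε : 0 ≤ ε) (hlcb : 0 ≤ εlcb)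
    (hucb : 0 ≤ εucb) (hX : 0 ≤ εX)
    (hE : ∀ᵐ ω ∂P, E.BoundErr ρ (G ω) ω εlcb εucb ∧ E.FrontErr ω εPF ∧ E.AcqErr R ω εX)
    {A : Set S} (hA : MeasurableSet A) (hPA : ENNReal.ofReal (1 - δ) ≤ P A)
    (hmem : ∀ ω ∈ A, ∀ t x j, (fun w => f j (x, w)) ∈ G ω t x j) :
    Guarantee P R E (fun x j => (ρ x j).val fun w => f j (x, w)) δ ε (εlcb + εucb + εX) := by
  -- The exceptional set of the error inequalities need not be measurable, so a measurable null
  -- superset is removed instead.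
  obtain ⟨N, hN, hNm, hN0⟩ := exists_measurable_superset_of_null (ae_iff.1 hE)
  refine ⟨A \ N, hA.diff hNm, by rwa [measure_sdiff_null hN0], fun ω hω => ?_⟩
  obtain ⟨hbound, hfront, hacq⟩ := not_not.1 fun h => hω.2 (hN h)
  have main : ∀ t, discrepancy (fun x j => (ρ x j).val fun w => f j (x, w)) (E.sol t ω) ≤
      E.acq t ω (R.x t ω) + ENNReal.ofReal (εlcb + εucb + εX) := fun t => by
    have h := discrepancy_le (F := fun x j => (ρ x j).val fun w => f j (x, w)) hlcb hucb
      (fun x j => (hbound t x j _ (hmem ω hω.1 t x j)).1)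
      (fun x j => (hbound t x j _ (hmem ω hω.1 t x j)).2)
      (hfront t).1 fun x => (le_iSup (E.acq t ω) x).trans (hacq t)
    refine h.trans (le_of_eq ?_)
    rw [ENNReal.ofReal_add (add_nonneg hlcb hucb) hX, add_assoc,
      add_comm (ENNReal.ofReal εX)]
  refine ⟨main, fun T hT => (main T).trans ?_⟩
  rw [ENNReal.ofReal_add hε (by positivity)]
  gcongr

end Confidence

end

end ParetoBO

theorem theorem4
    {d e : ℕ} (𝒳 : Set (EuclideanSpace ℝ (Fin d))) (Ω : Set (EuclideanSpace ℝ (Fin e)))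
    (h𝒳 : IsCompact 𝒳) (h𝒳' : Convex ℝ 𝒳) (hΩ : IsCompact Ω) (hΩ' : Convex ℝ Ω)
    {S : Type*} [MeasurableSpace S] (P : Measure S) [IsProbabilityMeasure P]
    {M : ℕ} (k : Fin M → 𝒳 × Ω → 𝒳 × Ω → ℝ) (f : Fin M → 𝒳 × Ω → ℝ) (B : Fin M → ℝ)
    (hreg : ∀ m, ParetoBO.Regular (k m) (B m) (f m))
    (R : ParetoBO.Run S 𝒳 Ω M)
    (δ : ℝ) (hδ : 0 < δ) (hδ' : δ < 1) (ε : ℝ) (hε : 0 < ε)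
    (εlcb εucb εPF εX εΩ : ℝ)
    (hlcb : 0 ≤ εlcb) (hucb : 0 ≤ εucb) (hPF : 0 ≤ εPF) (hX : 0 ≤ εX) (hΩε : 0 ≤ εΩ) :
    -- one risk measure per function, Gaussian noise, simulator setting
    (∀ (s : Fin M → ℝ), (∀ m, 0 < s m) → R.GaussianNoise P s →
      ∀ (ρ : Fin M → ParetoBO.RiskMeasure Ω), (∀ m x, (fun w => f m (x, w)) ∈ (ρ m).dom) →
      ∀ E : ParetoBO.Estimates S 𝒳 (Fin M),
      (∀ᵐ ω ∂P,
        E.BoundErr (fun _ m => ρ m)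
          (fun t x m => ParetoBO.band (ρ m) (fun w => ParetoBO.gMean k f s R ω m t (x, w))
            (fun w => ParetoBO.gSd k s R ω m t (x, w)) (ParetoBO.gBeta k B s δ m t))
          ω εlcb εucb ∧
        E.FrontErr ω εPF ∧
        E.AcqErr R ω εX ∧
        R.EnvErr (fun _ => Set.univ) (ParetoBO.gBeta k B s δ) (ParetoBO.gSd k s R ω) ω εΩ) →
      ParetoBO.Guarantee P R E (fun x m => (ρ m).val fun w => f m (x, w))
        δ ε (εlcb + εucb + εX)) ∧
    -- several risk measures per function, heteroscedastic sub-Gaussian noise, `x`-dependent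
    -- environment, in the simulator and in the uncontrollable setting
    (∀ (lam : Fin M → ℝ), (∀ m, 0 < lam m) →
      ∀ (τ : Fin M → 𝒳 × Ω → ℝ) (τlo τhi : ℝ), 0 < τlo → (∀ m, Measurable (τ m)) →
      (∀ m z, τ m z ∈ Set.Icc τlo τhi) → R.SubGaussianNoise P τ →
      ∀ (Ωx : 𝒳 → Set Ω), (∀ x, IsCompact (Ωx x)) → (∀ x, Convex ℝ (Subtype.val '' Ωx x)) →
      ∀ (r : ℕ) (L : Fin M → ℕ) (ρ : 𝒳 → (Σ m, Fin (L m)) → ParetoBO.RiskMeasure Ω),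
      (∀ x j, (fun w => f j.1 (x, w)) ∈ (ρ x j).dom) →
      ∀ E : ParetoBO.Estimates S 𝒳 (Σ m, Fin (L m)),
      (∀ᵐ ω ∂P,
        E.BoundErr ρ
          (fun t x j => ParetoBO.band (ρ x j)
            (fun w => ParetoBO.hMean k f lam τ R ω j.1 t (x, w))
            (fun w => ParetoBO.hSd k lam τ R ω j.1 t (x, w))
            (ParetoBO.hBeta k B lam δ τ r R ω j.1 t))
          ω εlcb εucb ∧
        E.FrontErr ω εPF ∧
        E.AcqErr R ω εX) →
      ((∀ᵐ ω ∂P, (∀ t, R.w t ω ∈ Ωx (R.x t ω)) ∧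
          R.EnvErr Ωx (ParetoBO.hBeta k B lam δ τ r R ω) (ParetoBO.hSd k lam τ R ω) ω εΩ) ∨
        ∃ Pw : ProbabilityTheory.Kernel 𝒳 Ω, ProbabilityTheory.IsMarkovKernel Pw ∧
          (∀ x, Pw x (Ωx x) = 1) ∧ R.SamplesEnv P Pw) →
      ParetoBO.Guarantee P R E (fun x j => (ρ x j).val fun w => f j.1 (x, w))
        δ ε (εlcb + εucb + εX)) := by
  have hpos : ∀ {lam : ℝ}, 0 < lam → ∀ m, (Matrix.of fun p q => 1 / lam * k m p q).PosSemidef :=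
    fun hlam m => ParetoBO.posSemidef_scaled (hreg m).posDef hlam
  refine ⟨fun s hs hnoise ρ hdom E hE => ?_,
    fun lam hlam τ τlo τhi hτlo hτm hτ hnoise Ωx _ _ r L ρ hdom E hE _ => ?_⟩
  -- Gaussian noise is the case `lam = 1` with constant `τ`.
  · obtain ⟨A, hA, hPA, hband⟩ := ParetoBO.exists_uniform_band (P := P) hreg R hδ
      (lam := fun _ => 1) (fun _ => one_pos) (τ := fun m _ => s m) (fun m => measurable_const)
      (fun m _ => hs m) hnoise.condSubGaussian
    refine ParetoBO.guarantee_of_band (f := f) (ρ := fun _ m => ρ m) hε.le hlcb hucb hX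
      (hE.mono fun ω h => ⟨h.1, h.2.1, h.2.2.1⟩) hA hPA fun ω hω t x m => ?_
    have hk1 : (fun p q => 1 / 1 * k m p q) = k m := by simp
    have hmean : ParetoBO.hMean k f (fun _ => 1) (fun m _ => s m) R ω m t =
        ParetoBO.gMean k f s R ω m t := by
      simp only [ParetoBO.hMean, hk1]; rfl
    have hsd : ParetoBO.hSd k (fun _ => 1) (fun m _ => s m) R ω m t =
        ParetoBO.gSd k s R ω m t := by
      simp only [ParetoBO.hSd, hk1]; rfl
    refine ParetoBO.mem_band_of_abs_sub_le (hdom m x) (fun w => Real.sqrt_nonneg _) ?_ fun w => by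
      have := hband ω hω m t (x, w)
      rwa [hmean, hsd] at this
    have hM : (0 : ℝ) < M := Nat.cast_pos.2 m.pos
    have hs2 : ∀ i : ℕ, 0 < (fun _ : ℕ => s m ^ 2) i := fun _ => pow_pos (hs m) 2
    have hD := ParetoBO.detRatio_pos (hreg m).posDef (R.pts t ω) (v := fun _ => s m ^ 2)
      fun _ => pow_pos (hs m) 2
    -- The band is built from `t` points but `gBeta` takes the information gain of `t + 1`;
    -- monotonicity absorbs the shift.
    have hmono := ParetoBO.detRatio_mono (hreg m).posDef (fun t => (R.x t ω, R.w t ω)) hs2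
      t.le_succ
    rw [ParetoBO.gBeta, ParetoBO.betaGauss, Real.sqrt_one, mul_one, hk1]
    change _ + √(2 * Real.log (√(ParetoBO.detRatio (k m) (R.pts t ω) fun _ => s m ^ 2) * _)) ≤ _
    rw [Real.log_mul (Real.sqrt_pos.2 hD).ne' (by positivity)]
    gcongr
    refine le_trans (Real.log_le_log (Real.sqrt_pos.2 hD) (Real.sqrt_le_sqrt hmono)) ?_
    exact ParetoBO.log_detRatio_le_infoGain (hreg m).posDef (hreg m).diag_le (hs m) _
  · have hτ0 : ∀ m z, 0 < τ m z := fun m z => hτlo.trans_le (hτ m z).1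
    obtain ⟨A, hA, hPA, hband⟩ := ParetoBO.exists_uniform_band (P := P) hreg R hδ hlam hτm hτ0
      hnoise.condSubGaussian
    refine ParetoBO.guarantee_of_band (f := fun j : (Σ m, Fin (L m)) => f j.1) (ρ := ρ)
      hε.le hlcb hucb hX hE hA hPA fun ω hω t x j => ?_
    refine ParetoBO.mem_band_of_abs_sub_le (hdom x j) (fun w => Real.sqrt_nonneg _) ?_
      fun w => hband ω hω j.1 t (x, w)
    have hM : (0 : ℝ) < M := Nat.cast_pos.2 j.1.pos
    have hv : ∀ i : ℕ, 0 < τ j.1 (R.x i ω, R.w i ω) ^ 2 := fun i => pow_pos (hτ0 _ _) 2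
    have hD := ParetoBO.detRatio_pos (hpos (hlam j.1) j.1) (R.pts t ω)
      (v := ParetoBO.vars τ R ω j.1 t) fun i => hv i
    -- The same monotonicity covers every offset `r`: the extra points only enlarge the radius.
    have hmono := ParetoBO.detRatio_mono (hpos (hlam j.1) j.1) (fun t => (R.x t ω, R.w t ω)) hv
      (Nat.le_add_right t r)
    rw [ParetoBO.hBeta, ParetoBO.betaSubG_eq (hreg j.1).posDef _ (hlam j.1) _ _ _
      (v := ParetoBO.vars τ R ω j.1 (t + r)) fun i => hv i]
    gcongr
    exact hmono
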